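/- **Model.** Time is slotted. Tasks arrive according to a discrete-time Markovian arrival process with phases $1,\dots,m$ and nonnegative $m\times m$ matrices $D_0\neq 0$, $D_1\neq 0$ such that $D=D_0+D_1$ is stochastic: $(D_0)_{ij}$ (resp. $(D_1)_{ij}$) is the probability of a phase change $i\to j$ in a slot without (resp. with) an arrival. Assume that $D$ has a unique stationary probability vector $\boldsymbol\pi$, and that the arrival rate $\lambda=\boldsymbol\pi D_1\mathbf e$ is positive. Queues 1 and 2 are first-in-first-out and have room for $N_1$ and $N_2$ tasks (the task in service included), $1\le N_1<N_2<\infty$. Transmission times (server 1), computation times (server 2) and vacations of server 1 are independent and have discrete phase-type distributions $(\beta_1,S_1)$, $(\beta_2,S_2)$, $(v,V)$ of finite orders; here the initial vectors are probability vectors (no mass at $0$), and $S_1,S_2,V$ are substochastic with $\mathbf I-S_1$, $\mathbf I-S_2$, $\mathbf I-V$ nonsingular. In a slot, a task whose transmission ends moves from queue 1 to queue 2, and a task whose computation ends leaves the system. An arriving task enters queue 1 if there is room in it (a place vacated in the same slot counts as room) and is rejected otherwise. When a transmission or a vacation of server 1 ends, or a task enters while server 1 is idle, then, with the queue lengths at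 the end of the slot, server 1 is idle if queue 1 is empty, starts a transmission if queue 1 is nonempty and queue 2 is not full, and starts a vacation if queue 1 is nonempty and queue 2 is full. Server 2 works whenever queue 2 is nonempty. The queue lengths, the arrival phase, and the current activities and phases of the two servers form a finite Markov chain with transition matrix $P$. Let $\mathbf x$ be a stationary distribution of it ($\mathbf x P=\mathbf x$, $\mathbf x\ge 0$, $\mathbf x\mathbf e=1$), and let $\mathbf x_{i_1 i_2}\mathbf e$ be the total mass that it gives to the states with $i_1$ tasks in queue 1 and $i_2$ tasks in queue 2. Let the chain start from $\mathbf x$, and consider any fixed slot. Let $P_{off}$ be the probability that a task enters queue 1 in that slot, given that a task arrives in it. Given that a task enters queue 1 in that slot, let $T\in\{1,2,\dots\}\cup\{\infty\}$ be the number of slots from the end of that slot until this task leaves queue 2, let $PW_n=P\{T=n\}$, and let $D_{ave}=E[T]$ be the average delay. **Proposition.** $P_{off}>0$, the average delay is finite, and $$D_{ave}=\sum_{n=1}^{\infty} n\,PW_n,\qquad\text{and}\qquad D_{ave}=\frac{\sum_{i_1=0}^{N_1}\sum_{i_2=0}^{N_2}(i_1+i_2)\,\mathbf x_{i_1 i_2}\mathbf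 e}{\lambda P_{off}} .$$ -/

import Mathlib

open MeasureTheory ProbabilityTheory
open scoped ENNReal

/-- A discrete-time Markovian arrival process with `m` phases: `D0 i j` (`D1 i j`) is the
probability of moving from phase `i` to phase `j` in a slot without (with) an arrival. -/
structure DMAP (m : ℕ) where
  D0 : Matrix (Fin m) (Fin m) ℝ
  D1 : Matrix (Fin m) (Fin m) ℝ
  D0_nonneg : ∀ i j, 0 ≤ D0 i j
  D1_nonneg : ∀ i j, 0 ≤ D1 i j
  row_sum : ∀ i, ∑ j, (D0 + D1) i j = 1
  D0_pos : ∃ i j, 0 < D0 i j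
  D1_pos : ∃ i j, 0 < D1 i j

namespace DMAP

variable {m : ℕ}

/-- `π` is a probability vector with `π D = π`, where `D = D0 + D1`. -/
def IsStationary (A : DMAP m) (π : Fin m → ℝ) : Prop :=
  (∀ i, 0 ≤ π i) ∧ ∑ i, π i = 1 ∧ Matrix.vecMul π (A.D0 + A.D1) = π

/-- The average number `π D1 e` of arrivals per slot. -/
def rate (A : DMAP m) (π : Fin m → ℝ) : ℝ :=
  ∑ j, Matrix.vecMul π A.D1 j

/-- The matrix of the phase changes with (`true`) or without (`false`) an arrival. -/
def step (A : DMAP m) (arrival : Bool) : Matrix (Fin m) (Fin m) ℝ :=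
  if arrival then A.D1 else A.D0

end DMAP

/-- A representation `(init, trans)` of order `n` of a discrete-time phase-type distribution on
`{1, 2, …}` (no mass at `0`). -/
structure DPH (n : ℕ) where
  init : Fin n → ℝ
  trans : Matrix (Fin n) (Fin n) ℝ
  init_nonneg : ∀ i, 0 ≤ init i
  init_sum : ∑ i, init i = 1
  trans_nonneg : ∀ i j, 0 ≤ trans i j
  row_sum_le : ∀ i, ∑ j, trans i j ≤ 1
  nonsingular : IsUnit (1 - trans)

/-- The absorption probabilities `e - T e`. -/
def DPH.exit {n : ℕ} (F : DPH n) (i : Fin n) : ℝ :=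
  1 - ∑ j, F.trans i j

/-- The parameters of the two-stage tandem queue: buffer sizes `N₁ < N₂`, the arrival process, and
the phase-type distributions of the transmission time (server 1), of the computation time
(server 2) and of one vacation of server 1. -/
structure TandemQueue where
  N₁ : ℕ
  N₂ : ℕ
  one_le_N₁ : 1 ≤ N₁
  N₁_lt_N₂ : N₁ < N₂
  m : ℕ
  n₁ : ℕ
  n₂ : ℕ
  l : ℕ
  arr : DMAP m
  trm : DPH n₁
  cmp : DPH n₂
  vac : DPH l

namespace TandemQueue

/-- Status of server 1: `none` is idle, `some (Sum.inl j)` is on vacation in phase `j`,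
`some (Sum.inr j)` is transmitting in phase `j`. -/
abbrev Status₁ (Q : TandemQueue) : Type := Option (Fin Q.l ⊕ Fin Q.n₁)

/-- Status of server 2: `none` is idle, `some j` is computing in phase `j`. -/
abbrev Status₂ (Q : TandemQueue) : Type := Option (Fin Q.n₂)

/-- Tuples (length of queue 1, length of queue 2, arrival phase, server 1, server 2). -/
abbrev RawState (Q : TandemQueue) : Type :=
  Fin (Q.N₁ + 1) × Fin (Q.N₂ + 1) × Fin Q.m × Q.Status₁ × Q.Status₂

/-- The tuples that are states: server 1 is idle exactly when queue 1 is empty, it can transmit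
only when queue 2 is not full, and server 2 is idle exactly when queue 2 is empty. -/
def Valid (Q : TandemQueue) (s : Q.RawState) : Prop :=
  ((s.1 : ℕ) = 0 ↔ s.2.2.2.1 = none) ∧
  ((s.2.1 : ℕ) = Q.N₂ → ∀ j : Fin Q.n₁, s.2.2.2.1 ≠ some (Sum.inr j)) ∧
  ((s.2.1 : ℕ) = 0 ↔ s.2.2.2.2 = none)

instance (Q : TandemQueue) : DecidablePred Q.Valid :=
  fun _ => inferInstanceAs (Decidable (_ ∧ _ ∧ _))

/-- The state space. -/
abbrev State (Q : TandemQueue) : Type := {s : Q.RawState // Q.Valid s}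

section State

variable {Q : TandemQueue}

/-- Number of tasks in queue 1, the one in transmission included. -/
def State.len₁ (s : Q.State) : ℕ := (s.1.1 : ℕ)

/-- Number of tasks in queue 2, the one in computation included. -/
def State.len₂ (s : Q.State) : ℕ := (s.1.2.1 : ℕ)

/-- The phase of the arrival process. -/
def State.phase (s : Q.State) : Fin Q.m := s.1.2.2.1

/-- The status of server 1. -/
def State.srv₁ (s : Q.State) : Q.Status₁ := s.1.2.2.2.1

/-- The status of server 2. -/
def State.srv₂ (s : Q.State) : Q.Status₂ := s.1.2.2.2.2

end State

/-- What happens in one slot: whether a task arrives, whether the current activity (transmission or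
vacation) of server 1 ends, whether the current computation of server 2 ends. -/
abbrev Event : Type := Bool × Bool × Bool

/-- A task arrives (it may be rejected). -/
def Event.arrival (e : Event) : Bool := e.1

/-- The current transmission or vacation of server 1 ends. -/
def Event.end₁ (e : Event) : Bool := e.2.1

/-- The current computation of server 2 ends, that is, a task leaves the system. -/
def Event.end₂ (e : Event) : Bool := e.2.2

/-- Number (0 or 1) of tasks that move from queue 1 to queue 2 in the slot. -/
def moved (Q : TandemQueue) (s : Q.State) (e : Event) : ℕ :=
  match s.srv₁ with
  | some (Sum.inr _) => if e.end₁ then 1 else 0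
  | _ => 0

/-- A task arrives in the slot and finds room in queue 1. A place that is vacated in the same slot
is available to it. -/
def Admits (Q : TandemQueue) (s : Q.State) (e : Event) : Prop :=
  e.arrival = true ∧ s.len₁ - Q.moved s e < Q.N₁

instance (Q : TandemQueue) (s : Q.State) (e : Event) : Decidable (Q.Admits s e) :=
  inferInstanceAs (Decidable (_ ∧ _))

/-- Length of queue 1 after the slot. -/
def next₁ (Q : TandemQueue) (s : Q.State) (e : Event) : ℕ :=
  s.len₁ - Q.moved s e + if Q.Admits s e then 1 else 0

/-- Length of queue 2 after the slot. -/
def next₂ (Q : TandemQueue) (s : Q.State) (e : Event) : ℕ :=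
  s.len₂ + Q.moved s e - if e.end₂ then 1 else 0

/-- Probability that server 1, having no activity in progress, takes the status `a` when the queues
have lengths `i₁` and `i₂`: idle if queue 1 is empty; otherwise a new transmission if queue 2 is not
full and a new vacation if queue 2 is full. -/
def start₁ (Q : TandemQueue) (i₁ i₂ : ℕ) (a : Q.Status₁) : ℝ :=
  match a with
  | none => if i₁ = 0 then 1 else 0
  | some (Sum.inl j) => if i₁ ≠ 0 ∧ i₂ = Q.N₂ then Q.vac.init j else 0
  | some (Sum.inr j) => if i₁ ≠ 0 ∧ i₂ ≠ Q.N₂ then Q.trm.init j else 0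

/-- Probability that server 2, having no computation in progress, takes the status `b` when queue 2
has length `i₂`. -/
def start₂ (Q : TandemQueue) (i₂ : ℕ) (b : Q.Status₂) : ℝ :=
  match b with
  | none => if i₂ = 0 then 1 else 0
  | some j => if i₂ ≠ 0 then Q.cmp.init j else 0

/-- Probability that the activity of server 1 with status `a` ends (`end₁ = true`) or not in the
slot and that its status becomes `a'`; `i₁`, `i₂` are the queue lengths after the slot. -/
def step₁ (Q : TandemQueue) (i₁ i₂ : ℕ) (a : Q.Status₁) (end₁ : Bool) (a' : Q.Status₁) : ℝ :=
  match a, end₁ with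
  | none, true => 0
  | none, false => Q.start₁ i₁ i₂ a'
  | some (Sum.inl j), true => Q.vac.exit j * Q.start₁ i₁ i₂ a'
  | some (Sum.inl j), false =>
      match a' with
      | some (Sum.inl j') => Q.vac.trans j j'
      | _ => 0
  | some (Sum.inr j), true => Q.trm.exit j * Q.start₁ i₁ i₂ a'
  | some (Sum.inr j), false =>
      match a' with
      | some (Sum.inr j') => Q.trm.trans j j'
      | _ => 0

/-- The analogue of `step₁` for server 2. -/
def step₂ (Q : TandemQueue) (i₂ : ℕ) (b : Q.Status₂) (end₂ : Bool) (b' : Q.Status₂) : ℝ :=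
  match b, end₂ with
  | none, true => 0
  | none, false => Q.start₂ i₂ b'
  | some j, true => Q.cmp.exit j * Q.start₂ i₂ b'
  | some j, false =>
      match b' with
      | some j' => Q.cmp.trans j j'
      | none => 0

/-- Probability that, from the state `s`, the events of the slot are `e` and the next state
is `s'`. -/
def kernel (Q : TandemQueue) (s : Q.State) (e : Event) (s' : Q.State) : ℝ :=
  if s'.len₁ = Q.next₁ s e ∧ s'.len₂ = Q.next₂ s e then
    Q.arr.step e.arrival s.phase s'.phase *
      Q.step₁ s'.len₁ s'.len₂ s.srv₁ e.end₁ s'.srv₁ *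
      Q.step₂ s'.len₂ s.srv₂ e.end₂ s'.srv₂
  else 0

/-- The one-step transition matrix of the chain of states. -/
def P (Q : TandemQueue) : Matrix Q.State Q.State ℝ :=
  fun s s' => ∑ e : Event, Q.kernel s e s'

/-- `x` is a probability vector with `x P = x`. -/
def IsStationary (Q : TandemQueue) (x : Q.State → ℝ) : Prop :=
  (∀ s, 0 ≤ x s) ∧ ∑ s, x s = 1 ∧ Matrix.vecMul x Q.P = x

/-- The stationary probability `x_{i₁ i₂} e` of the queue lengths `i₁` and `i₂`. -/
def levelProb (Q : TandemQueue) (x : Q.State → ℝ) (i₁ i₂ : ℕ) : ℝ :=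
  ∑ s : Q.State, if s.len₁ = i₁ ∧ s.len₂ = i₂ then x s else 0

/-- The stationary mean of the total number of tasks in both queues. -/
def meanNumber (Q : TandemQueue) (x : Q.State → ℝ) : ℝ :=
  ∑ i₁ ∈ Finset.range (Q.N₁ + 1), ∑ i₂ ∈ Finset.range (Q.N₂ + 1),
    ((i₁ : ℝ) + (i₂ : ℝ)) * Q.levelProb x i₁ i₂

section Run

variable {Ω : Type*} [MeasurableSpace Ω]

/-- `X i` is the state at time `t_i` and `E i` the events of the slot from `t_i` to `t_{i+1}` of the
tandem queue with initial distribution `x`: together they have the law of the Markov chain with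
the transition probabilities `kernel`. -/
structure IsRun (Q : TandemQueue) (x : Q.State → ℝ) (μ : Measure Ω)
    (X : ℕ → Ω → Q.State) (E : ℕ → Ω → Event) : Prop where
  measurable_state : ∀ i s, MeasurableSet (X i ⁻¹' {s})
  measurable_event : ∀ i e, MeasurableSet (E i ⁻¹' {e})
  law : ∀ (n : ℕ) (s : ℕ → Q.State) (e : ℕ → Event),
    μ {ω | (∀ i ≤ n, X i ω = s i) ∧ ∀ i < n, E i ω = e i} =
      ENNReal.ofReal (x (s 0) * ∏ i ∈ Finset.range n, Q.kernel (s i) (e i) (s (i + 1)))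

/-- A task arrives in slot `k`. -/
def arrives (E : ℕ → Ω → Event) (k : ℕ) : Set Ω :=
  {ω | (E k ω).arrival = true}

/-- A task arrives and enters queue 1 in slot `k`. -/
def enters (Q : TandemQueue) (X : ℕ → Ω → Q.State) (E : ℕ → Ω → Event) (k : ℕ) : Set Ω :=
  {ω | Q.Admits (X k ω) (E k ω)}

/-- Number of tasks that leave queue 2 during the `n` slots that follow time `t_k`. -/
def departures (E : ℕ → Ω → Event) (k n : ℕ) (ω : Ω) : ℕ :=
  ∑ i ∈ Finset.range n, if (E (k + i) ω).end₂ then 1 else 0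

/-- The delay, in slots, of the task that enters in slot `k`, and so is the last of all tasks in the
system at time `t_{k+1}`: as both queues are first-in-first-out, it leaves when as many tasks have
left as were then present. The value is `⊤` if this never happens. -/
noncomputable def delay (Q : TandemQueue) (X : ℕ → Ω → Q.State) (E : ℕ → Ω → Event) (k : ℕ)
    (ω : Ω) : ℕ∞ :=
  ⨅ (n : ℕ) (_ : (X (k + 1) ω).len₁ + (X (k + 1) ω).len₂ ≤ departures E (k + 1) n ω), (n : ℕ∞)

/-- The offloading ratio: the probability that a task arriving in slot `k` enters queue 1. -/
noncomputable def offloadingRatio (Q : TandemQueue) (μ : Measure Ω) (X : ℕ → Ω → Q.State)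
    (E : ℕ → Ω → Event) (k : ℕ) : ℝ :=
  (μ[|arrives E k] (Q.enters X E k)).toReal

/-- The probability that the delay of a task that enters in slot `k` is `n` slots. -/
noncomputable def delayProb (Q : TandemQueue) (μ : Measure Ω) (X : ℕ → Ω → Q.State)
    (E : ℕ → Ω → Event) (k n : ℕ) : ℝ≥0∞ :=
  μ[|Q.enters X E k] {ω | Q.delay X E k ω = (n : ℕ∞)}

/-- The average delay: the expected delay of a task that enters in slot `k`. -/
noncomputable def averageDelay (Q : TandemQueue) (μ : Measure Ω) (X : ℕ → Ω → Q.State)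
    (E : ℕ → Ω → Event) (k : ℕ) : ℝ≥0∞ :=
  ∫⁻ ω, ((Q.delay X E k ω : ℕ∞) : ℝ≥0∞) ∂(μ[|Q.enters X E k])

end Run

end TandemQueue

/-! The formula is Little's law, obtained from stationarity and a telescoping sum; neither
irreducibility of the chain nor an ergodic theorem is involved. Let `L` be the number of tasks at
time 0 and let `B n` be the number of these still present after `n` slots, that is, `L` minus the
departures so far, truncated at 0. Start the same count one slot later. By stationarity its mean is
unchanged; path by path it equals `B (n + 1)`, plus one exactly when a task enters in slot 0 and has
delay `T > n`. Hence `E[B n] - E[B (n + 1)] = P(enter, T > n)` (`lintegral_backlog_eq`). Summed over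
`n`, this gives `E[T; enter] = E[L]`, provided that `E[B n]` tends to 0 (`setLIntegral_delay`).

The proviso holds by dominated convergence once all tasks leave almost surely. A set of nonempty
states that is closed and free of departures would trap server 2, then a transmission, then a
vacation in a set of phases without exit, against nonsingularity
(`eq_empty_of_closed_of_no_departure`). The support of the limiting mass of the departure-free paths
would be such a set (`tendsto_stayProb`).

It remains to divide by `P(enter) = λ P_off`. The phase marginal of `x` is stationary for `D`, hence
equal to `π`, so an arrival has probability `λ`. Little's law also yields `P_off > 0`: if no task
ever entered, the system would be empty almost surely, and every arrival would then be admitted. As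
the quotient is a real number, the average delay is finite. -/

/-! ### Phase-type distributions and the arrival process. -/

namespace DPH

variable {n : ℕ}

lemma exit_nonneg (F : DPH n) (i : Fin n) : 0 ≤ F.exit i :=
  sub_nonneg.2 (F.row_sum_le i)

lemma exists_init_pos (F : DPH n) : ∃ j, 0 < F.init j := by
  by_contra! h
  have := Finset.sum_nonpos (s := Finset.univ) (fun j _ => h j)
  rw [F.init_sum] at this
  linarith

/-- Absorption is certain: no nonempty set of phases is closed under the transitions and has no
exit. -/
lemma not_closed_of_exit_eq_zero (F : DPH n) (J : Set (Fin n)) (hJ : J.Nonempty)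
    (hexit : ∀ j ∈ J, F.exit j = 0) (hclosed : ∀ j ∈ J, ∀ j', 0 < F.trans j j' → j' ∈ J) :
    False := by
  -- With `(1 - T) w = 1`, look at the point `j` of `J` where `w` is least. Row `j` of `T` is a
  -- probability vector carried by `J`, so `(T w) j ≥ w j`, whence `1 = w j - (T w) j ≤ 0`. The sign
  -- of `w` plays no role.
  obtain ⟨w, hw⟩ : ∃ w : Fin n → ℝ, (1 - F.trans).mulVec w = fun _ => 1 := by
    obtain ⟨B, hB⟩ := F.nonsingular.exists_right_inv
    exact ⟨B.mulVec fun _ => 1, by rw [Matrix.mulVec_mulVec, hB, Matrix.one_mulVec]⟩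
  obtain ⟨j, hj, hmin⟩ := Set.exists_min_image J w (Set.toFinite J) hJ
  have h := congrFun hw j
  rw [Matrix.sub_mulVec, Matrix.one_mulVec, Pi.sub_apply] at h
  simp only [Matrix.mulVec, dotProduct] at h
  have hle : ∑ j', F.trans j j' * w j ≤ ∑ j', F.trans j j' * w j' := by
    refine Finset.sum_le_sum fun j' _ => ?_
    rcases (F.trans_nonneg j j').eq_or_lt with h0 | hpos
    · simp [← h0]
    · exact mul_le_mul_of_nonneg_left (hmin j' (hclosed j hj j' hpos)) hpos.le
  have hsum : ∑ j', F.trans j j' = 1 := by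
    have := hexit j hj
    unfold exit at this
    linarith
  rw [← Finset.sum_mul, hsum] at hle
  linarith

end DPH

namespace DMAP

variable {m : ℕ}

lemma step_nonneg (A : DMAP m) (b : Bool) (i j : Fin m) : 0 ≤ A.step b i j := by
  cases b
  · exact A.D0_nonneg i j
  · exact A.D1_nonneg i j

lemma sum_step (A : DMAP m) (i : Fin m) : ∑ b, ∑ j, A.step b i j = 1 := by
  rw [← A.row_sum i]
  simp [step, Finset.sum_add_distrib, add_comm]

lemma exists_step_pos (A : DMAP m) (i : Fin m) : ∃ b j, 0 < A.step b i j := by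
  by_contra! h
  have := Finset.sum_nonpos (s := Finset.univ) fun b _ =>
    Finset.sum_nonpos (s := Finset.univ) (fun j _ => h b j)
  rw [A.sum_step i] at this
  linarith

end DMAP

/-! ### One-step transitions and the balance of tasks. -/

namespace TandemQueue

variable {Q : TandemQueue}

lemma State.len₁_eq_zero_iff (s : Q.State) : s.len₁ = 0 ↔ s.srv₁ = none := s.2.1

lemma State.srv₁_ne_transmit (s : Q.State) (h : s.len₂ = Q.N₂) (j : Fin Q.n₁) :
    s.srv₁ ≠ some (Sum.inr j) := s.2.2.1 h j

lemma State.len₂_eq_zero_iff (s : Q.State) : s.len₂ = 0 ↔ s.srv₂ = none := s.2.2.2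

lemma State.len₁_le (s : Q.State) : s.len₁ ≤ Q.N₁ := Nat.lt_succ_iff.1 s.1.1.2

lemma State.len₂_le (s : Q.State) : s.len₂ ≤ Q.N₂ := Nat.lt_succ_iff.1 s.1.2.1.2

lemma moved_transmit {s : Q.State} {j : Fin Q.n₁} (h : s.srv₁ = some (Sum.inr j)) (e : Event) :
    Q.moved s e = if e.end₁ then 1 else 0 := by
  simp [moved, h]

lemma moved_vacation {s : Q.State} {j : Fin Q.l} (h : s.srv₁ = some (Sum.inl j)) (e : Event) :
    Q.moved s e = 0 := by
  simp [moved, h]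

lemma moved_idle {s : Q.State} (h : s.srv₁ = none) (e : Event) : Q.moved s e = 0 := by
  simp [moved, h]

lemma moved_le_len₁ (s : Q.State) (e : Event) : Q.moved s e ≤ s.len₁ := by
  rcases h : s.srv₁ with _ | j | j
  · simp [moved_idle h]
  · simp [moved_vacation h]
  · have : s.len₁ ≠ 0 := by rw [Ne, s.len₁_eq_zero_iff, h]; simp
    rw [moved_transmit h]
    split <;> omega

lemma next₁_le (s : Q.State) (e : Event) : Q.next₁ s e ≤ Q.N₁ := by
  have := s.len₁_le
  unfold next₁
  split
  next h => exact h.2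
  next => omega

/-- Only a transmission can add to queue 2, and validity of the state excludes one while queue 2 is
full. -/
lemma next₂_le (s : Q.State) (e : Event) : Q.next₂ s e ≤ Q.N₂ := by
  have h2 := s.len₂_le
  unfold next₂
  rcases h : s.srv₁ with _ | j | j
  · rw [moved_idle h]; omega
  · rw [moved_vacation h]; omega
  · have : s.len₂ ≠ Q.N₂ := fun h' => s.srv₁_ne_transmit h' j h
    rw [moved_transmit h]
    split <;> omega

lemma start₁_nonneg (i₁ i₂ : ℕ) (a : Q.Status₁) : 0 ≤ Q.start₁ i₁ i₂ a := by
  rcases a with _ | j | j <;> simp only [start₁] <;> split <;>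
    first | exact zero_le_one | exact le_rfl | exact Q.vac.init_nonneg j
          | exact Q.trm.init_nonneg j

lemma start₂_nonneg (i₂ : ℕ) (b : Q.Status₂) : 0 ≤ Q.start₂ i₂ b := by
  rcases b with _ | j <;> simp only [start₂] <;> split <;>
    first | exact zero_le_one | exact le_rfl | exact Q.cmp.init_nonneg j

lemma sum_start₁ (i₁ i₂ : ℕ) : ∑ a, Q.start₁ i₁ i₂ a = 1 := by
  rw [Fintype.sum_option, Fintype.sum_sum_type]
  by_cases h : i₁ = 0 <;> by_cases h' : i₂ = Q.N₂ <;>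
    simp [start₁, h, h', Q.vac.init_sum, Q.trm.init_sum]

lemma sum_start₂ (i₂ : ℕ) : ∑ b, Q.start₂ i₂ b = 1 := by
  rw [Fintype.sum_option]
  by_cases h : i₂ = 0 <;> simp [start₂, h, Q.cmp.init_sum]

lemma exists_start₁_pos (i₁ i₂ : ℕ) : ∃ a, 0 < Q.start₁ i₁ i₂ a := by
  by_contra! h
  have := Finset.sum_nonpos (s := Finset.univ) (fun a _ => h a)
  rw [sum_start₁] at this
  linarith

lemma exists_start₂_pos (i₂ : ℕ) : ∃ b, 0 < Q.start₂ i₂ b := by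
  by_contra! h
  have := Finset.sum_nonpos (s := Finset.univ) (fun a _ => h a)
  rw [sum_start₂] at this
  linarith

lemma start₁_valid {i₁ i₂ : ℕ} {a : Q.Status₁} (h : Q.start₁ i₁ i₂ a ≠ 0) :
    (i₁ = 0 ↔ a = none) ∧ (i₂ = Q.N₂ → ∀ j : Fin Q.n₁, a ≠ some (Sum.inr j)) := by
  rcases a with _ | j | j <;> simp [start₁] at h ⊢
  · exact h
  · tauto
  · tauto

lemma start₂_valid {i₂ : ℕ} {b : Q.Status₂} (h : Q.start₂ i₂ b ≠ 0) : i₂ = 0 ↔ b = none := by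
  rcases b with _ | j <;> simp [start₂] at h ⊢
  · exact h
  · exact h.1

lemma step₁_nonneg (i₁ i₂ : ℕ) (a : Q.Status₁) (c : Bool) (a' : Q.Status₁) :
    0 ≤ Q.step₁ i₁ i₂ a c a' := by
  rcases a with _ | j | j <;> cases c
  · exact start₁_nonneg _ _ _
  · exact le_rfl
  · rcases a' with _ | j' | j'
    exacts [le_rfl, Q.vac.trans_nonneg _ _, le_rfl]
  · exact mul_nonneg (Q.vac.exit_nonneg _) (start₁_nonneg _ _ _)
  · rcases a' with _ | j' | j'
    exacts [le_rfl, le_rfl, Q.trm.trans_nonneg _ _]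
  · exact mul_nonneg (Q.trm.exit_nonneg _) (start₁_nonneg _ _ _)

lemma step₂_nonneg (i₂ : ℕ) (b : Q.Status₂) (c : Bool) (b' : Q.Status₂) :
    0 ≤ Q.step₂ i₂ b c b' := by
  rcases b with _ | j <;> cases c
  · exact start₂_nonneg _ _
  · exact le_rfl
  · rcases b' with _ | j'
    exacts [le_rfl, Q.cmp.trans_nonneg _ _]
  · exact mul_nonneg (Q.cmp.exit_nonneg _) (start₂_nonneg _ _)

/-- Probability that the activity of server 1 ends, or does not end, in a slot. -/
def endProb₁ (Q : TandemQueue) (a : Q.Status₁) (c : Bool) : ℝ :=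
  match a, c with
  | none, true => 0
  | none, false => 1
  | some (Sum.inl j), true => Q.vac.exit j
  | some (Sum.inl j), false => 1 - Q.vac.exit j
  | some (Sum.inr j), true => Q.trm.exit j
  | some (Sum.inr j), false => 1 - Q.trm.exit j

/-- Probability that the computation of server 2 ends, or does not end, in a slot. -/
def endProb₂ (Q : TandemQueue) (b : Q.Status₂) (c : Bool) : ℝ :=
  match b, c with
  | none, true => 0
  | none, false => 1
  | some j, true => Q.cmp.exit j
  | some j, false => 1 - Q.cmp.exit j

lemma sum_step₁ (i₁ i₂ : ℕ) (a : Q.Status₁) (c : Bool) :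
    ∑ a', Q.step₁ i₁ i₂ a c a' = Q.endProb₁ a c := by
  rcases a with _ | j | j <;> cases c
  · exact sum_start₁ _ _
  · simp [step₁, endProb₁]
  · rw [Fintype.sum_option, Fintype.sum_sum_type]
    simp [step₁, endProb₁, DPH.exit]
  · simp only [step₁, endProb₁, ← Finset.mul_sum, sum_start₁, mul_one]
  · rw [Fintype.sum_option, Fintype.sum_sum_type]
    simp [step₁, endProb₁, DPH.exit]
  · simp only [step₁, endProb₁, ← Finset.mul_sum, sum_start₁, mul_one]

lemma sum_step₂ (i₂ : ℕ) (b : Q.Status₂) (c : Bool) :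
    ∑ b', Q.step₂ i₂ b c b' = Q.endProb₂ b c := by
  rcases b with _ | j <;> cases c
  · exact sum_start₂ _
  · simp [step₂, endProb₂]
  · rw [Fintype.sum_option]
    simp [step₂, endProb₂, DPH.exit]
  · simp only [step₂, endProb₂, ← Finset.mul_sum, sum_start₂, mul_one]

lemma sum_endProb₁ (a : Q.Status₁) : ∑ c, Q.endProb₁ a c = 1 := by
  rcases a with _ | j | j <;> simp [endProb₁]

lemma sum_endProb₂ (b : Q.Status₂) : ∑ c, Q.endProb₂ b c = 1 := by
  rcases b with _ | j <;> simp [endProb₂]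

/-- The statuses that have positive probability after a slot are compatible with the queue
lengths. -/
lemma next_valid {s : Q.State} {e : Event} {a : Q.Status₁} {b : Q.Status₂}
    (h₁ : Q.step₁ (Q.next₁ s e) (Q.next₂ s e) s.srv₁ e.end₁ a ≠ 0)
    (h₂ : Q.step₂ (Q.next₂ s e) s.srv₂ e.end₂ b ≠ 0) :
    (Q.next₁ s e = 0 ↔ a = none) ∧
      (Q.next₂ s e = Q.N₂ → ∀ j : Fin Q.n₁, a ≠ some (Sum.inr j)) ∧
      (Q.next₂ s e = 0 ↔ b = none) := by
  rw [← and_assoc]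
  constructor
  · rcases h : s.srv₁ with _ | j | j <;> rcases hc : e.end₁ with _ | _ <;> rw [h, hc] at h₁
    · exact start₁_valid h₁
    · exact absurd rfl h₁
    · have hlen : s.len₁ ≠ 0 := by rw [Ne, s.len₁_eq_zero_iff, h]; simp
      have hnext : Q.next₁ s e ≠ 0 := by rw [next₁, moved_vacation h]; omega
      rcases a with _ | j' | j'
      · exact absurd rfl h₁
      · simp [hnext]
      · exact absurd rfl h₁
    · exact start₁_valid (right_ne_zero_of_mul h₁)
    -- A transmission that continues moves nothing: queue 1 stays nonempty, and queue 2, not full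
    -- before, cannot fill up.
    · have hlen : s.len₁ ≠ 0 := by rw [Ne, s.len₁_eq_zero_iff, h]; simp
      have hlen₂ : s.len₂ ≠ Q.N₂ := fun h' => s.srv₁_ne_transmit h' j h
      have hle := s.len₂_le
      have hm : Q.moved s e = 0 := by rw [moved_transmit h, hc]; simp
      have hnext : Q.next₁ s e ≠ 0 := by rw [next₁, hm]; omega
      have hnext₂ : Q.next₂ s e ≠ Q.N₂ := by rw [next₂, hm]; omega
      rcases a with _ | j' | j'
      · exact absurd rfl h₁
      · exact absurd rfl h₁
      · simp [hnext, hnext₂]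
    · exact start₁_valid (right_ne_zero_of_mul h₁)
  · rcases h : s.srv₂ with _ | j <;> rcases hc : e.end₂ with _ | _ <;> rw [h, hc] at h₂
    · exact start₂_valid h₂
    · exact absurd rfl h₂
    · have hlen : s.len₂ ≠ 0 := by rw [Ne, s.len₂_eq_zero_iff, h]; simp
      have hnext : Q.next₂ s e ≠ 0 := by rw [next₂, hc]; simp [hlen]
      rcases b with _ | j'
      · exact absurd rfl h₂
      · simp [hnext]
    · exact start₂_valid (right_ne_zero_of_mul h₂)

lemma kernel_nonneg (s : Q.State) (e : Event) (s' : Q.State) : 0 ≤ Q.kernel s e s' := by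
  unfold kernel
  split
  · exact mul_nonneg (mul_nonneg (Q.arr.step_nonneg _ _ _) (step₁_nonneg _ _ _ _ _))
      (step₂_nonneg _ _ _ _)
  · exact le_rfl

/-- A combination of positive-probability changes of the arrival phase and of the two servers is a
transition of the chain. -/
lemma exists_kernel_pos {s : Q.State} {e : Event} {p : Fin Q.m} {a : Q.Status₁} {b : Q.Status₂}
    (h₀ : 0 < Q.arr.step e.arrival s.phase p)
    (h₁ : 0 < Q.step₁ (Q.next₁ s e) (Q.next₂ s e) s.srv₁ e.end₁ a)
    (h₂ : 0 < Q.step₂ (Q.next₂ s e) s.srv₂ e.end₂ b) :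
    ∃ s' : Q.State, s'.srv₁ = a ∧ s'.srv₂ = b ∧ 0 < Q.kernel s e s' := by
  refine ⟨⟨(⟨Q.next₁ s e, Nat.lt_succ_of_le (next₁_le s e)⟩,
    ⟨Q.next₂ s e, Nat.lt_succ_of_le (next₂_le s e)⟩, p, a, b), next_valid h₁.ne' h₂.ne'⟩,
    rfl, rfl, ?_⟩
  unfold kernel
  rw [if_pos ⟨rfl, rfl⟩]
  exact mul_pos (mul_pos h₀ h₁) h₂

/-- The law of the arrival phase and of the statuses of the servers after a slot. -/
lemma sum_kernel_mul (s : Q.State) (e : Event) (g : Fin Q.m → Q.Status₁ → Q.Status₂ → ℝ) :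
    ∑ s' : Q.State, Q.kernel s e s' * g s'.phase s'.srv₁ s'.srv₂ =
      ∑ p, ∑ a, ∑ b, Q.arr.step e.arrival s.phase p *
        Q.step₁ (Q.next₁ s e) (Q.next₂ s e) s.srv₁ e.end₁ a *
        Q.step₂ (Q.next₂ s e) s.srv₂ e.end₂ b * g p a b := by
  let F : Q.RawState → ℝ := fun r =>
    if (r.1 : ℕ) = Q.next₁ s e ∧ (r.2.1 : ℕ) = Q.next₂ s e then
      Q.arr.step e.arrival s.phase r.2.2.1 *
        Q.step₁ (Q.next₁ s e) (Q.next₂ s e) s.srv₁ e.end₁ r.2.2.2.1 *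
        Q.step₂ (Q.next₂ s e) s.srv₂ e.end₂ r.2.2.2.2 * g r.2.2.1 r.2.2.2.1 r.2.2.2.2
    else 0
  have hF : ∀ s' : Q.State, Q.kernel s e s' * g s'.phase s'.srv₁ s'.srv₂ = F s'.1 := by
    intro s'
    by_cases h : s'.len₁ = Q.next₁ s e ∧ s'.len₂ = Q.next₂ s e
    · have h' : (s'.1.1 : ℕ) = Q.next₁ s e ∧ (s'.1.2.1 : ℕ) = Q.next₂ s e := h
      simp only [kernel, F, if_pos h, if_pos h']
      rw [h.1, h.2]
      rfl
    · have h' : ¬ ((s'.1.1 : ℕ) = Q.next₁ s e ∧ (s'.1.2.1 : ℕ) = Q.next₂ s e) := h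
      simp only [kernel, F, if_neg h, if_neg h', zero_mul]
  -- Tuples that are not states carry no weight, so the sum over states extends to all tuples and
  -- splits into sums over the coordinates.
  have hvalid : ∀ r, F r ≠ 0 → Q.Valid r := by
    intro r hr
    simp only [F] at hr
    split at hr
    next h =>
      have h' := left_ne_zero_of_mul hr
      have := next_valid (right_ne_zero_of_mul (left_ne_zero_of_mul h'))
        (right_ne_zero_of_mul h')
      rw [← h.1, ← h.2] at this
      exact this
    next => exact absurd rfl hr
  have hsub : ∑ s' : Q.State, F s'.1 = ∑ r, F r := by
    rw [← Finset.sum_filter_of_ne (p := Q.Valid) (fun r _ h => hvalid r h)]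
    exact (Finset.sum_subtype _ (by simp) F).symm
  rw [Finset.sum_congr rfl fun s' _ => hF s', hsub, Fintype.sum_prod_type,
    Finset.sum_eq_single ⟨Q.next₁ s e, Nat.lt_succ_of_le (next₁_le s e)⟩, Fintype.sum_prod_type,
    Finset.sum_eq_single ⟨Q.next₂ s e, Nat.lt_succ_of_le (next₂_le s e)⟩, Fintype.sum_prod_type]
  · simp only [Fintype.sum_prod_type]
    simp [F]
  · intro i _ hi
    refine Finset.sum_eq_zero fun r _ => if_neg fun h => hi (Fin.ext h.2)
  · simp
  · intro i _ hi
    refine Finset.sum_eq_zero fun r _ => if_neg fun h => hi (Fin.ext h.1)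
  · simp

/-- The arrival process is not influenced by the queues. -/
lemma sum_kernel_phase (s : Q.State) (c : Bool) (g : Fin Q.m → ℝ) :
    ∑ d : Bool × Bool, ∑ s' : Q.State, Q.kernel s (c, d) s' * g s'.phase =
      ∑ p, Q.arr.step c s.phase p * g p := by
  have h : ∀ d : Bool × Bool, ∑ s' : Q.State, Q.kernel s (c, d) s' * g s'.phase =
      (∑ p, Q.arr.step c s.phase p * g p) * Q.endProb₁ s.srv₁ d.1 * Q.endProb₂ s.srv₂ d.2 := by
    intro d
    have hcomm : ∀ t u v w : ℝ, t * u * v * w = t * w * u * v := fun _ _ _ _ => by ring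
    rw [sum_kernel_mul s (c, d) fun p _ _ => g p]
    simp only [hcomm _ _ _ (g _), ← Finset.mul_sum, ← Finset.sum_mul, sum_step₁, sum_step₂]
    rfl
  simp only [h, Fintype.sum_prod_type, ← Finset.mul_sum, sum_endProb₂, sum_endProb₁, mul_one]

lemma sum_kernel (s : Q.State) : ∑ e, ∑ s', Q.kernel s e s' = 1 := by
  rw [Fintype.sum_prod_type, ← Q.arr.sum_step s.phase]
  refine Finset.sum_congr rfl fun c _ => ?_
  simpa using sum_kernel_phase s c fun _ => 1

/-- What a transition tells about the queue lengths. -/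
lemma len_of_kernel_pos {s s' : Q.State} {e : Event} (h : 0 < Q.kernel s e s') :
    s'.len₁ = Q.next₁ s e ∧ s'.len₂ = Q.next₂ s e ∧ (e.end₂ = true → 0 < s.len₂) := by
  unfold kernel at h
  split at h
  next hl =>
    refine ⟨hl.1, hl.2, fun he => Nat.pos_of_ne_zero fun h0 => ?_⟩
    rw [he, (s.len₂_eq_zero_iff).1 h0] at h
    simp [step₂] at h
  next => exact absurd h (lt_irrefl _)

/-- The balance of the number of tasks in the system over one slot. -/
lemma total_balance {s s' : Q.State} {e : Event} (h : 0 < Q.kernel s e s') :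
    s'.len₁ + s'.len₂ + (if e.end₂ then 1 else 0) =
      s.len₁ + s.len₂ + if Q.Admits s e then 1 else 0 := by
  obtain ⟨h₁, h₂, h₃⟩ := len_of_kernel_pos h
  -- The natural-number subtractions in `next₁` and `next₂` are exact: a moved task comes from queue
  -- 1, and a departure requires a nonempty queue 2.
  have hm := moved_le_len₁ s e
  rw [h₁, h₂, next₁, next₂]
  by_cases he : e.end₂ = true
  · have := h₃ he
    simp only [he, if_true]
    omega
  · simp only [he]
    simp
    omega

end TandemQueue

/-! ### A nonempty system eventually has a departure. -/

namespace TandemQueue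

variable {Q : TandemQueue}

/-- The outcome `c` is chosen before the queue lengths because the lengths after the slot depend on
it. -/
lemma exists_step₁_pos (a : Q.Status₁) : ∃ c, ∀ i₁ i₂, ∃ a', 0 < Q.step₁ i₁ i₂ a c a' := by
  obtain ⟨c, hc⟩ : ∃ c, 0 < Q.endProb₁ a c := by
    by_contra! h
    have := Finset.sum_nonpos (s := Finset.univ) (fun c _ => h c)
    rw [sum_endProb₁] at this
    linarith
  refine ⟨c, fun i₁ i₂ => ?_⟩
  by_contra! h
  have := Finset.sum_nonpos (s := Finset.univ) (fun a' _ => h a')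
  rw [sum_step₁] at this
  linarith

lemma exists_step₂_pos (b : Q.Status₂) : ∃ c, ∀ i₂, ∃ b', 0 < Q.step₂ i₂ b c b' := by
  obtain ⟨c, hc⟩ : ∃ c, 0 < Q.endProb₂ b c := by
    by_contra! h
    have := Finset.sum_nonpos (s := Finset.univ) (fun c _ => h c)
    rw [sum_endProb₂] at this
    linarith
  refine ⟨c, fun i₂ => ?_⟩
  by_contra! h
  have := Finset.sum_nonpos (s := Finset.univ) (fun b' _ => h b')
  rw [sum_step₂] at this
  linarith

/-- A nonempty system eventually has a departure: no set of states with tasks in the system is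
closed under the transitions and free of departures. -/
theorem eq_empty_of_closed_of_no_departure (A : Set Q.State)
    (hA : ∀ s ∈ A, ∀ e s', 0 < Q.kernel s e s' → e.end₂ = false ∧ s' ∈ A)
    (hpos : ∀ s ∈ A, 0 < s.len₁ + s.len₂) : A = ∅ := by
  -- Computing phases that occur in `A` have no exit, since an exit is a departure, and they are
  -- closed under `Q.cmp.trans`.
  have hcmp : ∀ s ∈ A, ∀ j, s.srv₂ ≠ some j := by
    intro s hs j hj
    refine Q.cmp.not_closed_of_exit_eq_zero {j | ∃ s ∈ A, s.srv₂ = some j} ⟨j, s, hs, hj⟩ ?_ ?_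
    · rintro j ⟨s, hs, hj⟩
      by_contra hne
      have hexit := (Q.cmp.exit_nonneg j).lt_of_ne' hne
      obtain ⟨c, p, hp⟩ := Q.arr.exists_step_pos s.phase
      obtain ⟨c₁, h₁⟩ := exists_step₁_pos s.srv₁
      obtain ⟨a, ha⟩ := h₁ (Q.next₁ s (c, c₁, true)) (Q.next₂ s (c, c₁, true))
      obtain ⟨b, hb⟩ := Q.exists_start₂_pos (Q.next₂ s (c, c₁, true))
      obtain ⟨s', -, -, hk⟩ := exists_kernel_pos (s := s) (e := (c, c₁, true)) (b := b) hp ha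
        (by rw [hj]; exact mul_pos hexit hb)
      exact absurd (hA s hs _ s' hk).1 (by simp [Event.end₂])
    · rintro j ⟨s, hs, hj⟩ j' hj'
      obtain ⟨c, p, hp⟩ := Q.arr.exists_step_pos s.phase
      obtain ⟨c₁, h₁⟩ := exists_step₁_pos s.srv₁
      obtain ⟨a, ha⟩ := h₁ (Q.next₁ s (c, c₁, false)) (Q.next₂ s (c, c₁, false))
      obtain ⟨s', -, hs', hk⟩ := exists_kernel_pos (s := s) (e := (c, c₁, false))
        (b := some j') hp ha (by rw [hj]; exact hj')
      exact ⟨s', (hA s hs _ s' hk).2, hs'⟩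
  have hlen₂ : ∀ s ∈ A, s.len₂ = 0 := fun s hs =>
    s.len₂_eq_zero_iff.2 (Option.eq_none_iff_forall_not_mem.2 fun j hj => hcmp s hs j hj)
  -- Queue 2 is now empty throughout `A`, whereas the end of a transmission would put a task into
  -- it.
  have htrm : ∀ s ∈ A, ∀ j, s.srv₁ ≠ some (Sum.inr j) := by
    intro s hs j hj
    refine Q.trm.not_closed_of_exit_eq_zero {j | ∃ s ∈ A, s.srv₁ = some (Sum.inr j)}
      ⟨j, s, hs, hj⟩ ?_ ?_
    · rintro j ⟨s, hs, hj⟩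
      by_contra hne
      have hexit := (Q.trm.exit_nonneg j).lt_of_ne' hne
      obtain ⟨c, p, hp⟩ := Q.arr.exists_step_pos s.phase
      obtain ⟨c₂, h₂⟩ := exists_step₂_pos s.srv₂
      obtain ⟨b, hb⟩ := h₂ (Q.next₂ s (c, true, c₂))
      obtain ⟨a, ha⟩ := Q.exists_start₁_pos (Q.next₁ s (c, true, c₂)) (Q.next₂ s (c, true, c₂))
      obtain ⟨s', -, -, hk⟩ := exists_kernel_pos (s := s) (e := (c, true, c₂)) (a := a) hp
        (by rw [hj]; exact mul_pos hexit ha) hb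
      obtain ⟨hend, hs'⟩ := hA s hs _ s' hk
      have hl := (len_of_kernel_pos hk).2.1
      rw [hlen₂ s' hs', next₂, moved_transmit hj, hend] at hl
      simp [Event.end₁] at hl
    · rintro j ⟨s, hs, hj⟩ j' hj'
      obtain ⟨c, p, hp⟩ := Q.arr.exists_step_pos s.phase
      obtain ⟨c₂, h₂⟩ := exists_step₂_pos s.srv₂
      obtain ⟨b, hb⟩ := h₂ (Q.next₂ s (c, false, c₂))
      obtain ⟨s', hs', -, hk⟩ := exists_kernel_pos (s := s) (e := (c, false, c₂))
        (a := some (Sum.inr j')) hp (by rw [hj]; exact hj') hb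
      exact ⟨s', (hA s hs _ s' hk).2, hs'⟩
  -- When a vacation ends, queue 1 is nonempty and queue 2, being empty, is not full because `N₂ >
  -- 0`; a transmission would start, which is already excluded.
  have hvac : ∀ s ∈ A, ∀ j, s.srv₁ ≠ some (Sum.inl j) := by
    intro s hs j hj
    refine Q.vac.not_closed_of_exit_eq_zero {j | ∃ s ∈ A, s.srv₁ = some (Sum.inl j)}
      ⟨j, s, hs, hj⟩ ?_ ?_
    · rintro j ⟨s, hs, hj⟩
      by_contra hne
      have hexit := (Q.vac.exit_nonneg j).lt_of_ne' hne
      obtain ⟨c, p, hp⟩ := Q.arr.exists_step_pos s.phase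
      obtain ⟨c₂, h₂⟩ := exists_step₂_pos s.srv₂
      obtain ⟨b, hb⟩ := h₂ (Q.next₂ s (c, true, c₂))
      obtain ⟨i, hi⟩ := Q.trm.exists_init_pos
      have hn₁ : Q.next₁ s (c, true, c₂) ≠ 0 := by
        have := hpos s hs
        rw [hlen₂ s hs] at this
        rw [next₁, moved_vacation hj]
        omega
      have hn₂ : Q.next₂ s (c, true, c₂) ≠ Q.N₂ := by
        have := Q.N₁_lt_N₂
        rw [next₂, moved_vacation hj, hlen₂ s hs]
        omega
      obtain ⟨s', hs', -, hk⟩ := exists_kernel_pos (s := s) (e := (c, true, c₂))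
        (a := some (Sum.inr i)) hp
        (by rw [hj]; exact mul_pos hexit (by simpa [start₁, hn₁, hn₂] using hi)) hb
      exact htrm s' (hA s hs _ s' hk).2 i hs'
    · rintro j ⟨s, hs, hj⟩ j' hj'
      obtain ⟨c, p, hp⟩ := Q.arr.exists_step_pos s.phase
      obtain ⟨c₂, h₂⟩ := exists_step₂_pos s.srv₂
      obtain ⟨b, hb⟩ := h₂ (Q.next₂ s (c, false, c₂))
      obtain ⟨s', hs', -, hk⟩ := exists_kernel_pos (s := s) (e := (c, false, c₂))
        (a := some (Sum.inl j')) hp (by rw [hj]; exact hj') hb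
      exact ⟨s', (hA s hs _ s' hk).2, hs'⟩
  refine Set.eq_empty_of_forall_notMem fun s hs => ?_
  have hp := hpos s hs
  rw [hlen₂ s hs, add_zero] at hp
  rcases h : s.srv₁ with _ | j | j
  · exact hp.ne' (s.len₁_eq_zero_iff.2 h)
  · exact hvac s hs j h
  · exact htrm s hs j h

/-- Transition probabilities of the slots without a departure. -/
def stayKernel (Q : TandemQueue) (s s' : Q.State) : ℝ :=
  ∑ e : Event, if e.end₂ then 0 else Q.kernel s e s'

/-- Probability of being in state `s` after `n` slots, having started in a nonempty system and seen
no departure. -/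
def stayProb (Q : TandemQueue) (x : Q.State → ℝ) : ℕ → Q.State → ℝ
  | 0, s => if 0 < s.len₁ + s.len₂ then x s else 0
  | n + 1, s' => ∑ s, Q.stayProb x n s * Q.stayKernel s s'

lemma stayKernel_nonneg (s s' : Q.State) : 0 ≤ Q.stayKernel s s' :=
  Finset.sum_nonneg fun e _ => by
    split
    exacts [le_rfl, kernel_nonneg _ _ _]

lemma stayKernel_le (s s' : Q.State) : Q.stayKernel s s' ≤ Q.P s s' :=
  Finset.sum_le_sum fun e _ => by
    split
    exacts [kernel_nonneg _ _ _, le_rfl]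

lemma stayProb_nonneg {x : Q.State → ℝ} (hx : Q.IsStationary x) (n : ℕ) (s : Q.State) :
    0 ≤ Q.stayProb x n s := by
  induction n generalizing s with
  | zero =>
    unfold stayProb
    split
    exacts [hx.1 s, le_rfl]
  | succ n ih => exact Finset.sum_nonneg fun s' _ => mul_nonneg (ih s') (stayKernel_nonneg _ _)

/-- Without a departure the number of tasks cannot decrease. -/
lemma stayKernel_eq_zero {s s' : Q.State} (h : 0 < s.len₁ + s.len₂)
    (h' : ¬ 0 < s'.len₁ + s'.len₂) : Q.stayKernel s s' = 0 := by
  refine Finset.sum_eq_zero fun e _ => ?_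
  split
  · rfl
  next he =>
    by_contra hne
    have hb := total_balance ((kernel_nonneg s e s').lt_of_ne' hne)
    simp only [he] at hb
    simp at hb
    omega

/-- The first step is bounded by `x P = x` at nonempty states, while empty states receive no mass.
Later steps inherit the inequality because `stayKernel` is nonnegative. -/
lemma stayProb_antitone {x : Q.State → ℝ} (hx : Q.IsStationary x) (s : Q.State) :
    Antitone fun n => Q.stayProb x n s := by
  refine antitone_nat_of_succ_le fun n => ?_
  induction n generalizing s with
  | zero =>
    by_cases hs : 0 < s.len₁ + s.len₂
    · have h0 : Q.stayProb x 0 s = x s := by simp [stayProb, hs]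
      rw [h0]
      calc Q.stayProb x 1 s ≤ ∑ s', x s' * Q.P s' s := by
            refine Finset.sum_le_sum fun s' _ =>
              mul_le_mul ?_ (stayKernel_le _ _) (stayKernel_nonneg _ _) (hx.1 s')
            unfold stayProb
            split
            exacts [le_rfl, hx.1 s']
        _ = x s := congrFun hx.2.2 s
    · refine (Finset.sum_nonpos fun s' _ => ?_).trans (stayProb_nonneg hx 0 s)
      by_cases hs' : 0 < s'.len₁ + s'.len₂
      · simp [stayKernel_eq_zero hs' hs]
      · simp [stayProb, hs']
  | succ n ih =>
    exact Finset.sum_le_sum fun s' _ => mul_le_mul_of_nonneg_right (ih s') (stayKernel_nonneg _ _)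

/-- In the long run there is a departure. -/
theorem tendsto_stayProb {x : Q.State → ℝ} (hx : Q.IsStationary x) (s : Q.State) :
    Filter.Tendsto (fun n => Q.stayProb x n s) Filter.atTop (nhds 0) := by
  have hbdd : ∀ s, BddBelow (Set.range fun n => Q.stayProb x n s) := fun s =>
    ⟨0, by rintro _ ⟨n, rfl⟩; exact stayProb_nonneg hx n s⟩
  -- The limit satisfies `y = y K` with `K` substochastic. Summation over the states forces the rows
  -- of `K` on the support of `y` to have sum 1, so no departure is possible there, and the support
  -- is closed.
  let y : Q.State → ℝ := fun s => ⨅ n, Q.stayProb x n s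
  have hlim : ∀ s, Filter.Tendsto (fun n => Q.stayProb x n s) Filter.atTop (nhds (y s)) :=
    fun s => tendsto_atTop_ciInf (stayProb_antitone hx s) (hbdd s)
  have hy0 : ∀ s, 0 ≤ y s := fun s => le_ciInf fun n => stayProb_nonneg hx n s
  have hyK : ∀ s', y s' = ∑ s, y s * Q.stayKernel s s' := fun s' =>
    tendsto_nhds_unique ((hlim s').comp (Filter.tendsto_add_atTop_nat 1))
      (tendsto_finsetSum _ fun s _ => (hlim s).mul_const _)
  have hrow : ∀ s, ∑ s', Q.stayKernel s s' ≤ 1 := by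
    intro s
    rw [← sum_kernel s, Finset.sum_comm]
    exact Finset.sum_le_sum fun s' _ => stayKernel_le s s'
  have hmass : ∑ s, y s * (1 - ∑ s', Q.stayKernel s s') = 0 := by
    simp only [mul_sub, mul_one, Finset.sum_sub_distrib, Finset.mul_sum]
    rw [Finset.sum_comm, ← Finset.sum_sub_distrib]
    exact Finset.sum_eq_zero fun s _ => sub_eq_zero.2 (hyK s)
  have hone : ∀ s, 0 < y s → ∑ s', Q.stayKernel s s' = 1 := by
    intro s hs
    have := (Finset.sum_eq_zero_iff_of_nonneg fun s _ =>
      mul_nonneg (hy0 s) (sub_nonneg.2 (hrow s))).1 hmass s (Finset.mem_univ s)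
    rcases mul_eq_zero.1 this with h | h
    · exact absurd h hs.ne'
    · linarith
  have hempty : {s | 0 < y s} = ∅ := by
    refine eq_empty_of_closed_of_no_departure _ ?_ ?_
    · intro s hs e s' hk
      have hend : e.end₂ = false := by
        by_contra he
        have hlt : ∑ s', Q.stayKernel s s' < ∑ s', Q.P s s' := by
          refine Finset.sum_lt_sum (fun s' _ => stayKernel_le s s')
            ⟨s', Finset.mem_univ _, Finset.sum_lt_sum (fun e _ => ?_)
              ⟨e, Finset.mem_univ _, ?_⟩⟩
          · split
            exacts [kernel_nonneg _ _ _, le_rfl]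
          · rw [if_pos (by simpa using he)]
            exact hk
        have : ∑ s', Q.P s s' = 1 := by
          rw [← sum_kernel s, Finset.sum_comm]
          rfl
        rw [this, hone s hs] at hlt
        exact lt_irrefl _ hlt
      refine ⟨hend, ?_⟩
      have hK : 0 < Q.stayKernel s s' := by
        refine Finset.sum_pos' (fun e _ => ?_) ⟨e, Finset.mem_univ _, ?_⟩
        · split
          exacts [le_rfl, kernel_nonneg _ _ _]
        · simpa [hend] using hk
      show 0 < y s'
      rw [hyK s']
      exact Finset.sum_pos' (fun s _ => mul_nonneg (hy0 s) (stayKernel_nonneg _ _))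
        ⟨s, Finset.mem_univ _, mul_pos hs hK⟩
    · intro s hs
      by_contra h
      -- The initial mass lies on nonempty states and decreases with `n`, so the limit lives there
      -- too.
      have h1 : y s ≤ Q.stayProb x 0 s := ciInf_le (hbdd s) 0
      rw [stayProb, if_neg h] at h1
      exact absurd hs (not_lt.2 h1)
  have : y s = 0 := le_antisymm (not_lt.1 fun h => by
    have : s ∈ {s | 0 < y s} := h
    rw [hempty] at this
    exact this) (hy0 s)
  rw [← this]
  exact hlim s

/-! ### Stationary arrival rate and mean number of tasks. -/

/-- In stationarity the arrival phase has the stationary distribution of the arrival process. -/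
lemma isStationary_phase {x : Q.State → ℝ} (hx : Q.IsStationary x) :
    Q.arr.IsStationary fun p => ∑ s : Q.State, if s.phase = p then x s else 0 := by
  refine ⟨fun p => Finset.sum_nonneg fun s _ => ?_, ?_, ?_⟩
  · split
    exacts [hx.1 s, le_rfl]
  · rw [Finset.sum_comm, ← hx.2.1]
    simp
  · funext p
    have hs : ∀ s, ∑ s', Q.P s s' * (if s'.phase = p then 1 else 0) =
        (Q.arr.D0 + Q.arr.D1) s.phase p := by
      intro s
      have h : ∀ c, _ := fun c => sum_kernel_phase s c fun q => if q = p then 1 else 0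
      calc ∑ s', Q.P s s' * (if s'.phase = p then 1 else 0)
          = ∑ c, ∑ d : Bool × Bool, ∑ s', Q.kernel s (c, d) s' * (if s'.phase = p then 1 else 0) := by
            simp only [P, Finset.sum_mul]
            rw [Finset.sum_comm, Fintype.sum_prod_type]
        _ = _ := by
            simp only [h]
            simp [DMAP.step, add_comm]
    calc Matrix.vecMul (fun p => ∑ s : Q.State, if s.phase = p then x s else 0)
          (Q.arr.D0 + Q.arr.D1) p
        = ∑ s, x s * (Q.arr.D0 + Q.arr.D1) s.phase p := by
          simp only [Matrix.vecMul, dotProduct, Finset.sum_mul]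
          rw [Finset.sum_comm]
          simp [ite_mul]
      _ = ∑ s', (∑ s, x s * Q.P s s') * (if s'.phase = p then 1 else 0) := by
          simp only [← hs, Finset.mul_sum, Finset.sum_mul]
          rw [Finset.sum_comm]
          simp only [mul_assoc]
      _ = ∑ s, if s.phase = p then x s else 0 := by
          refine Finset.sum_congr rfl fun s' _ => ?_
          rw [show ∑ s, x s * Q.P s s' = x s' from congrFun hx.2.2 s', mul_ite, mul_one, mul_zero]

/-- The probability of an arrival in a slot, if the state has distribution `x`. -/
lemma sum_kernel_arrival (x : Q.State → ℝ) :
    ∑ s, x s * ∑ d : Bool × Bool, ∑ s', Q.kernel s (true, d) s' =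
      Q.arr.rate fun p => ∑ s : Q.State, if s.phase = p then x s else 0 := by
  have hs : ∀ s : Q.State, ∑ d : Bool × Bool, ∑ s', Q.kernel s (true, d) s' =
      ∑ p, Q.arr.D1 s.phase p := fun s => by
    simpa [DMAP.step] using sum_kernel_phase s true fun _ => 1
  simp only [hs, DMAP.rate, Matrix.vecMul, dotProduct, Finset.sum_mul, Finset.mul_sum]
  rw [Finset.sum_comm]
  refine Finset.sum_congr rfl fun p _ => ?_
  rw [Finset.sum_comm]
  simp [ite_mul]

lemma meanNumber_eq_sum (x : Q.State → ℝ) :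
    Q.meanNumber x = ∑ s : Q.State, x s * ((s.len₁ + s.len₂ : ℕ) : ℝ) := by
  simp only [meanNumber, levelProb, Finset.mul_sum]
  rw [Finset.sum_congr rfl fun i _ => Finset.sum_comm, Finset.sum_comm]
  refine Finset.sum_congr rfl fun s _ => ?_
  rw [Finset.sum_eq_single s.len₁, Finset.sum_eq_single s.len₂]
  · simp [mul_comm]
  · intro i _ hi
    simp [hi.symm]
  · intro h
    exact absurd (Finset.mem_range.2 (Nat.lt_succ_of_le s.len₂_le)) h
  · intro i _ hi
    simp [hi.symm]
  · intro h
    exact absurd (Finset.mem_range.2 (Nat.lt_succ_of_le s.len₁_le)) h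

end TandemQueue

/-! ### Path probabilities of a stationary run. -/

/-- Only `Y` has to be measurable: the event `A` that is split is arbitrary. -/
lemma MeasureTheory.measure_eq_sum_inter_preimage {Ω ι : Type*} [MeasurableSpace Ω] [Fintype ι]
    (μ : Measure Ω) {Y : Ω → ι} (hY : ∀ i, MeasurableSet (Y ⁻¹' {i})) (A : Set Ω) :
    μ A = ∑ i, μ (A ∩ Y ⁻¹' {i}) := by
  have h := sum_measure_preimage_singleton (μ := μ.restrict A) Finset.univ fun i _ => hY i
  simp only [Finset.coe_univ, Set.preimage_univ, Measure.restrict_apply_univ] at h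
  rw [← h]
  exact Finset.sum_congr rfl fun i _ => by
    rw [Measure.restrict_apply (hY i), Set.inter_comm]

namespace TandemQueue

variable {Q : TandemQueue} {Ω : Type*} [MeasurableSpace Ω] {x : Q.State → ℝ} {μ : Measure Ω}
  {X : ℕ → Ω → Q.State} {E : ℕ → Ω → Event}

namespace IsRun

lemma measurableSet_setOf (h : Q.IsRun x μ X E) (i j : ℕ) (p : Q.State → Event → Prop) :
    MeasurableSet {ω | p (X i ω) (E j ω)} := by
  have : {ω | p (X i ω) (E j ω)} =
      ⋃ z ∈ {z : Q.State × Event | p z.1 z.2}, X i ⁻¹' {z.1} ∩ E j ⁻¹' {z.2} := by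
    ext ω
    simp
  rw [this]
  exact MeasurableSet.biUnion (Set.to_countable _) fun z _ =>
    (h.measurable_state i z.1).inter (h.measurable_event j z.2)

lemma measurable_comp_state (h : Q.IsRun x μ X E) {β : Type*} [MeasurableSpace β] (i : ℕ)
    (f : Q.State → β) : Measurable fun ω => f (X i ω) :=
  fun B _ => h.measurableSet_setOf i 0 fun s _ => f s ∈ B

lemma measurable_comp_event (h : Q.IsRun x μ X E) {β : Type*} [MeasurableSpace β] (i : ℕ)
    (f : Event → β) : Measurable fun ω => f (E i ω) :=
  fun B _ => h.measurableSet_setOf 0 i fun _ e => f e ∈ B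

lemma measurable_departures (h : Q.IsRun x μ X E) (k n : ℕ) :
    Measurable (departures E k n) :=
  Finset.measurable_sum _ fun i _ =>
    h.measurable_comp_event (k + i) fun e => if e.end₂ then 1 else 0

lemma measure_init (h : Q.IsRun x μ X E) (s : Q.State) : μ {ω | X 0 ω = s} = ENNReal.ofReal (x s) := by
  simpa using h.law 0 (fun _ => s) fun _ => default

lemma measure_step (h : Q.IsRun x μ X E) (s : Q.State) (e : Event) (s' : Q.State) :
    μ {ω | X 0 ω = s ∧ E 0 ω = e ∧ X 1 ω = s'} = ENNReal.ofReal (x s * Q.kernel s e s') := by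
  have := h.law 1 (fun i => if i = 0 then s else s') fun _ => e
  simp only [Finset.prod_range_one, if_true, zero_add, one_ne_zero, if_false] at this
  rw [← this]
  congr 1
  ext ω
  constructor
  · rintro ⟨h0, he, h1⟩
    refine ⟨fun i hi => ?_, fun i hi => ?_⟩
    · interval_cases i <;> simpa
    · interval_cases i; exact he
  · rintro ⟨hX, hE⟩
    exact ⟨by simpa using hX 0 (by simp), hE 0 (by simp), by simpa using hX 1 le_rfl⟩

lemma measurableSet_path (h : Q.IsRun x μ X E) (n : ℕ)
    (z : (Fin (n + 1) → Q.State) × (Fin n → Event)) :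
    MeasurableSet ((fun ω => ((fun i : Fin (n + 1) => X i ω, fun i : Fin n => E i ω) :
      (Fin (n + 1) → Q.State) × (Fin n → Event))) ⁻¹' {z}) := by
  have : (fun ω => ((fun i : Fin (n + 1) => X i ω, fun i : Fin n => E i ω) :
      (Fin (n + 1) → Q.State) × (Fin n → Event))) ⁻¹' {z} =
      (⋂ i : Fin (n + 1), X (i : ℕ) ⁻¹' {z.1 i}) ∩ ⋂ i : Fin n, E (i : ℕ) ⁻¹' {z.2 i} := by
    ext ω
    simp [Prod.ext_iff, funext_iff]
  rw [this]
  exact (MeasurableSet.iInter fun i : Fin (n + 1) => h.measurable_state (i : ℕ) (z.1 i)).inter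
    (MeasurableSet.iInter fun i : Fin n => h.measurable_event (i : ℕ) (z.2 i))

/-- The Markov property: given the past, the events of the next slot and the next state have the
law `kernel`. -/
lemma markov (h : Q.IsRun x μ X E) (hx : ∀ s, 0 ≤ x s) (n : ℕ) (G : Set Ω)
    (hG : ∀ ω ω', (∀ i ≤ n, X i ω' = X i ω) → (∀ i < n, E i ω' = E i ω) → ω ∈ G → ω' ∈ G)
    (s : Q.State) (e : Event) (s' : Q.State) :
    μ (G ∩ {ω | X n ω = s ∧ E n ω = e ∧ X (n + 1) ω = s'}) =
      μ (G ∩ {ω | X n ω = s}) * ENNReal.ofReal (Q.kernel s e s') := by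
  let Y : Ω → (Fin (n + 1) → Q.State) × (Fin n → Event) := fun ω => (fun i => X i ω, fun i => E i ω)
  have hYeq : ∀ ω ω₀, Y ω = Y ω₀ ↔ (∀ i ≤ n, X i ω = X i ω₀) ∧ ∀ i < n, E i ω = E i ω₀ := by
    intro ω ω₀
    simp only [Y, Prod.mk.injEq, funext_iff, Fin.forall_iff, Nat.lt_succ_iff]
  have hY : ∀ z, MeasurableSet (Y ⁻¹' {z}) := h.measurableSet_path n
  rw [measure_eq_sum_inter_preimage μ hY, measure_eq_sum_inter_preimage μ hY (G ∩ {ω | X n ω = s}),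
    Finset.sum_mul]
  refine Finset.sum_congr rfl fun z _ => ?_
  -- Given the path up to time `n`, the event `G` is all or nothing by `hG`. If the path is
  -- compatible with it, the two sides are instances of `law` that differ by the last factor;
  -- otherwise both vanish.
  by_cases hne : (G ∩ {ω | X n ω = s} ∩ Y ⁻¹' {z}).Nonempty
  · obtain ⟨ω₀, ⟨hω₀, hs⟩, rfl⟩ := hne
    have h1 : G ∩ {ω | X n ω = s} ∩ Y ⁻¹' {Y ω₀} =
        {ω | (∀ i ≤ n, X i ω = X i ω₀) ∧ ∀ i < n, E i ω = E i ω₀} := by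
      ext ω
      constructor
      · rintro ⟨-, hω⟩
        exact (hYeq ω ω₀).1 hω
      · intro hω
        exact ⟨⟨hG ω₀ ω hω.1 hω.2 hω₀, (hω.1 n le_rfl).trans hs⟩, (hYeq ω ω₀).2 hω⟩
    have h2 : G ∩ {ω | X n ω = s ∧ E n ω = e ∧ X (n + 1) ω = s'} ∩ Y ⁻¹' {Y ω₀} =
        {ω | (∀ i ≤ n + 1, X i ω = if i ≤ n then X i ω₀ else s') ∧
          ∀ i < n + 1, E i ω = if i < n then E i ω₀ else e} := by
      ext ω
      constructor
      · rintro ⟨⟨-, -, he, hs'⟩, hω⟩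
        have hω := (hYeq ω ω₀).1 hω
        refine ⟨fun i hi => ?_, fun i hi => ?_⟩
        · split
          next hin => exact hω.1 i hin
          next hin => rwa [show i = n + 1 by omega]
        · split
          next hin => exact hω.2 i hin
          next hin => rwa [show i = n by omega]
      · rintro ⟨hX, hE⟩
        have hX' : ∀ i ≤ n, X i ω = X i ω₀ := fun i hi => by
          simpa [hi] using hX i (by omega)
        have hE' : ∀ i < n, E i ω = E i ω₀ := fun i hi => by
          simpa [hi] using hE i (by omega)
        exact ⟨⟨hG ω₀ ω hX' hE' hω₀, (hX' n le_rfl).trans hs, by simpa using hE n (by omega),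
          by simpa using hX (n + 1) le_rfl⟩, (hYeq ω ω₀).2 ⟨hX', hE'⟩⟩
    rw [h1, h2, h.law n (fun i => X i ω₀) (fun i => E i ω₀),
      h.law (n + 1) (fun i => if i ≤ n then X i ω₀ else s') (fun i => if i < n then E i ω₀ else e),
      ← ENNReal.ofReal_mul (mul_nonneg (hx _) (Finset.prod_nonneg fun i _ => kernel_nonneg _ _ _)),
      Finset.prod_range_succ]
    have hprod : ∏ i ∈ Finset.range n, Q.kernel (if i ≤ n then X i ω₀ else s')
          (if i < n then E i ω₀ else e) (if i + 1 ≤ n then X (i + 1) ω₀ else s') =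
        ∏ i ∈ Finset.range n, Q.kernel (X i ω₀) (E i ω₀) (X (i + 1) ω₀) := by
      refine Finset.prod_congr rfl fun i hi => ?_
      have hi := Finset.mem_range.1 hi
      rw [if_pos hi.le, if_pos hi, if_pos (Nat.succ_le_of_lt hi)]
    rw [hprod]
    have hs : X n ω₀ = s := hs
    simp [hs, mul_assoc]
  · rw [Set.not_nonempty_iff_eq_empty] at hne
    rw [hne, measure_empty, zero_mul]
    refine measure_mono_null ?_ (measure_empty (μ := μ))
    rw [← hne]
    exact fun ω hω => ⟨⟨hω.1.1, hω.1.2.1⟩, hω.2⟩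

/-- The chain is stationary. -/
lemma shift_one (h : Q.IsRun x μ X E) (hx : Q.IsStationary x) :
    Q.IsRun x μ (fun i => X (i + 1)) fun i => E (i + 1) where
  measurable_state i s := h.measurable_state (i + 1) s
  measurable_event i e := h.measurable_event (i + 1) e
  law n s e := by
    rw [measure_eq_sum_inter_preimage μ (Y := fun ω => (X 0 ω, E 0 ω))
      (fun z => h.measurableSet_setOf 0 0 fun s e => (s, e) = z)]
    have hz : ∀ z : Q.State × Event,
        μ ({ω | (∀ i ≤ n, X (i + 1) ω = s i) ∧ ∀ i < n, E (i + 1) ω = e i} ∩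
          (fun ω => (X 0 ω, E 0 ω)) ⁻¹' {z}) =
        ENNReal.ofReal (x z.1 * Q.kernel z.1 z.2 (s 0) *
          ∏ i ∈ Finset.range n, Q.kernel (s i) (e i) (s (i + 1))) := by
      intro z
      -- Prepend the state and the events of slot 0; summed over these, the extra factor is `x P =
      -- x`.
      have := h.law (n + 1) (fun i => Nat.casesOn i z.1 s) (fun i => Nat.casesOn i z.2 e)
      rw [Finset.prod_range_succ'] at this
      simp only [Nat.rec_zero] at this
      rw [mul_assoc, mul_comm (Q.kernel _ _ _), ← this]
      congr 1
      ext ω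
      constructor
      · rintro ⟨⟨hX, hE⟩, hω⟩
        have hω : (X 0 ω, E 0 ω) = z := hω
        subst hω
        refine ⟨fun i hi => ?_, fun i hi => ?_⟩
        · rcases i with _ | i
          exacts [rfl, hX i (by omega)]
        · rcases i with _ | i
          exacts [rfl, hE i (by omega)]
      · rintro ⟨hX, hE⟩
        exact ⟨⟨fun i hi => hX (i + 1) (by omega), fun i hi => hE (i + 1) (by omega)⟩,
          Prod.ext (hX 0 (by omega)) (hE 0 (by omega))⟩
    rw [Finset.sum_congr rfl fun z _ => hz z, ← ENNReal.ofReal_sum_of_nonneg fun z _ =>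
      mul_nonneg (mul_nonneg (hx.1 _) (kernel_nonneg _ _ _))
        (Finset.prod_nonneg fun i _ => kernel_nonneg _ _ _), ← Finset.sum_mul,
      Fintype.sum_prod_type]
    simp only [← Finset.mul_sum]
    congr 2
    exact congrFun hx.2.2 (s 0)

lemma shift (h : Q.IsRun x μ X E) (hx : Q.IsStationary x) (k : ℕ) :
    Q.IsRun x μ (fun i => X (k + i)) fun i => E (k + i) := by
  induction k with
  | zero => simpa using h
  | succ k ih =>
    have := ih.shift_one hx
    simpa only [add_assoc, add_comm 1] using this

/-- Functionals of finitely many slots have the same mean for all runs with the same initial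
distribution. -/
lemma lintegral_eq {X' : ℕ → Ω → Q.State} {E' : ℕ → Ω → Event} (h : Q.IsRun x μ X E)
    (h' : Q.IsRun x μ X' E') (n : ℕ) (Φ : (ℕ → Q.State) → (ℕ → Event) → ℝ≥0∞)
    (hΦ : ∀ s s' e e', (∀ i ≤ n, s i = s' i) → (∀ i < n, e i = e' i) → Φ s e = Φ s' e') :
    ∫⁻ ω, Φ (fun i => X i ω) (fun i => E i ω) ∂μ =
      ∫⁻ ω, Φ (fun i => X' i ω) (fun i => E' i ω) ∂μ := by
  rcases isEmpty_or_nonempty Ω with hΩ | hΩ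
  · simp [lintegral_of_isEmpty]
  have s₀ : Q.State := X 0 (Classical.arbitrary Ω)
  -- Finite paths are continued by arbitrary values, which `Φ` does not see.
  let S : (Fin (n + 1) → Q.State) → ℕ → Q.State := fun z i =>
    if hi : i < n + 1 then z ⟨i, hi⟩ else s₀
  let T : (Fin n → Event) → ℕ → Event := fun z i => if hi : i < n then z ⟨i, hi⟩ else default
  have key : ∀ {X : ℕ → Ω → Q.State} {E : ℕ → Ω → Event}, Q.IsRun x μ X E →
      ∫⁻ ω, Φ (fun i => X i ω) (fun i => E i ω) ∂μ =
        ∑ z : (Fin (n + 1) → Q.State) × (Fin n → Event), Φ (S z.1) (T z.2) *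
          ENNReal.ofReal (x (S z.1 0) * ∏ i ∈ Finset.range n,
            Q.kernel (S z.1 i) (T z.2 i) (S z.1 (i + 1))) := by
    intro X E h
    let Y : Ω → (Fin (n + 1) → Q.State) × (Fin n → Event) :=
      fun ω => (fun i => X i ω, fun i => E i ω)
    have hYeq : ∀ z, Y ⁻¹' {z} = {ω | (∀ i ≤ n, X i ω = S z.1 i) ∧ ∀ i < n, E i ω = T z.2 i} := by
      intro z
      ext ω
      simp only [Y, S, T, Set.mem_preimage, Set.mem_singleton_iff, Prod.ext_iff, funext_iff,
        Fin.forall_iff, Set.mem_ofPred_eq]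
      refine and_congr (forall_congr' fun i => ?_) (forall_congr' fun i => ?_)
      · rw [← Nat.lt_succ_iff]
        exact forall_congr' fun hi => by rw [dif_pos hi]
      · exact forall_congr' fun hi => by rw [dif_pos hi]
    have hY : ∀ z, MeasurableSet (Y ⁻¹' {z}) := h.measurableSet_path n
    let _ : MeasurableSpace ((Fin (n + 1) → Q.State) × (Fin n → Event)) := ⊤
    have hYm : Measurable Y := measurable_to_countable' hY
    have hcomp : ∀ ω, Φ (fun i => X i ω) (fun i => E i ω) = Φ (S (Y ω).1) (T (Y ω).2) := by
      intro ω
      refine hΦ _ _ _ _ (fun i hi => ?_) fun i hi => ?_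
      · simp only [S, Y, dif_pos (Nat.lt_succ_of_le hi)]
      · simp [T, Y, hi]
    simp only [hcomp]
    rw [← lintegral_map (f := fun z => Φ (S z.1) (T z.2)) measurable_from_top hYm,
      lintegral_fintype]
    refine Finset.sum_congr rfl fun z _ => ?_
    rw [Measure.map_apply hYm (MeasurableSpace.measurableSet_top), hYeq,
      h.law n (S z.1) (T z.2)]
  rw [key h, key h']

/-- Almost surely all transitions have positive probability. -/
lemma ae_kernel_pos (h : Q.IsRun x μ X E) (hx : Q.IsStationary x) :
    ∀ᵐ ω ∂μ, ∀ i, 0 < Q.kernel (X i ω) (E i ω) (X (i + 1) ω) := by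
  rw [ae_all_iff]
  intro i
  have hi := h.shift hx i
  have hsub : {ω | ¬ 0 < Q.kernel (X i ω) (E i ω) (X (i + 1) ω)} ⊆
      ⋃ z ∈ {z : Q.State × Event × Q.State | ¬ 0 < Q.kernel z.1 z.2.1 z.2.2},
        {ω | X (i + 0) ω = z.1 ∧ E (i + 0) ω = z.2.1 ∧ X (i + 1) ω = z.2.2} := by
    intro ω hω
    simp only [Set.mem_iUnion]
    exact ⟨(X i ω, E i ω, X (i + 1) ω), hω, rfl, rfl, rfl⟩
  refine measure_mono_null hsub ((measure_biUnion_null_iff (Set.to_countable _)).2 ?_)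
  rintro ⟨s, e, s'⟩ hz
  rw [hi.measure_step s e s', ENNReal.ofReal_eq_zero]
  exact mul_nonpos_of_nonneg_of_nonpos (hx.1 s) (not_lt.1 hz)

/-- This reads the recursion `stayProb` as a path probability, so that `tendsto_stayProb` controls
the event that no departure ever occurs. -/
lemma measure_stay (h : Q.IsRun x μ X E) (hx : Q.IsStationary x) (n : ℕ) (s : Q.State) :
    μ ({ω | 0 < (X 0 ω).len₁ + (X 0 ω).len₂ ∧ ∀ i < n, (E i ω).end₂ = false} ∩
      {ω | X n ω = s}) = ENNReal.ofReal (Q.stayProb x n s) := by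
  induction n generalizing s with
  | zero =>
    simp only [not_lt_zero, false_implies, implies_true, and_true, stayProb]
    split
    next hs =>
      rw [← h.measure_init s]
      congr 1
      ext ω
      exact ⟨fun hω => hω.2, fun hω => ⟨by rw [Set.mem_ofPred_eq, show X 0 ω = s from hω]; exact hs, hω⟩⟩
    next hs =>
      rw [ENNReal.ofReal_zero]
      refine measure_mono_null (t := ∅) ?_ measure_empty
      rintro ω ⟨h1, h2⟩
      rw [Set.mem_ofPred_eq] at h1 h2
      rw [h2] at h1
      exact hs h1
  | succ n ih =>
    rw [measure_eq_sum_inter_preimage μ (Y := fun ω => (X n ω, E n ω))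
      (fun z => h.measurableSet_setOf n n fun s e => (s, e) = z), Fintype.sum_prod_type]
    have hz : ∀ (t : Q.State) (e : Event),
        μ ({ω | 0 < (X 0 ω).len₁ + (X 0 ω).len₂ ∧ ∀ i < n + 1, (E i ω).end₂ = false} ∩
          {ω | X (n + 1) ω = s} ∩ (fun ω => (X n ω, E n ω)) ⁻¹' {(t, e)}) =
        ENNReal.ofReal (Q.stayProb x n t * if e.end₂ then 0 else Q.kernel t e s) := by
      intro t e
      by_cases he : e.end₂ = true
      · rw [if_pos he, mul_zero, ENNReal.ofReal_zero]
        refine measure_mono_null (t := ∅) ?_ measure_empty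
        rintro ω ⟨⟨⟨-, h1⟩, -⟩, h2⟩
        have h2 := congrArg Prod.snd (show (X n ω, E n ω) = (t, e) from h2)
        have h1 := h1 n (by omega)
        rw [show E n ω = e from h2, he] at h1
        exact absurd h1 (by simp)
      · rw [if_neg he, ENNReal.ofReal_mul (stayProb_nonneg hx n t), ← ih t, ← h.markov hx.1 n]
        · congr 1
          ext ω
          simp only [Set.mem_inter_iff, Set.mem_ofPred_eq, Set.mem_preimage, Set.mem_singleton_iff,
            Prod.mk.injEq]
          constructor
          · rintro ⟨⟨⟨h1, h2⟩, h3⟩, h4, h5⟩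
            exact ⟨⟨h1, fun i hi => h2 i (by omega)⟩, h4, h5, h3⟩
          · rintro ⟨⟨h1, h2⟩, h4, h5, h3⟩
            refine ⟨⟨⟨h1, fun i hi => ?_⟩, h3⟩, h4, h5⟩
            rcases Nat.lt_succ_iff_lt_or_eq.1 hi with hi | rfl
            · exact h2 i hi
            · rw [h5]
              simpa using he
        · rintro ω ω' hX hE ⟨h1, h2⟩
          exact ⟨by rw [hX 0 (Nat.zero_le _)]; exact h1, fun i hi => by rw [hE i hi]; exact h2 i hi⟩
    simp only [hz]
    have hnn : ∀ (t : Q.State) (e : Event),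
        0 ≤ Q.stayProb x n t * if e.end₂ then 0 else Q.kernel t e s := fun t e =>
      mul_nonneg (stayProb_nonneg hx n t) (by split; exacts [le_rfl, kernel_nonneg _ _ _])
    rw [Finset.sum_congr rfl fun t _ => (ENNReal.ofReal_sum_of_nonneg fun e _ => hnn t e).symm,
      ← ENNReal.ofReal_sum_of_nonneg fun t _ => Finset.sum_nonneg fun e _ => hnn t e]
    simp only [← Finset.mul_sum]
    rfl

lemma ae_exists_departure_zero (h : Q.IsRun x μ X E) (hx : Q.IsStationary x) :
    ∀ᵐ ω ∂μ, 0 < (X 0 ω).len₁ + (X 0 ω).len₂ → ∃ i, (E i ω).end₂ = true := by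
  have hle : ∀ n, μ {ω | ¬ (0 < (X 0 ω).len₁ + (X 0 ω).len₂ → ∃ i, (E i ω).end₂ = true)} ≤
      ENNReal.ofReal (∑ s, Q.stayProb x n s) := by
    intro n
    rw [ENNReal.ofReal_sum_of_nonneg fun s _ => stayProb_nonneg hx n s,
      ← Finset.sum_congr rfl fun s _ => h.measure_stay hx n s]
    refine (measure_mono fun ω hω => ?_).trans
      (measure_eq_sum_inter_preimage μ (fun s => h.measurable_state n s) _).le
    simp only [Set.mem_ofPred_eq, Classical.not_imp, not_exists, Bool.not_eq_true] at hω
    exact ⟨hω.1, fun i _ => hω.2 i⟩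
  have hlim : Filter.Tendsto (fun n => ENNReal.ofReal (∑ s, Q.stayProb x n s)) Filter.atTop
      (nhds 0) := by
    have := ENNReal.tendsto_ofReal (tendsto_finsetSum Finset.univ fun s _ => tendsto_stayProb hx s)
    simpa using this
  exact le_antisymm (ge_of_tendsto' hlim hle) bot_le

/-- Almost surely, a nonempty system has a departure later on. -/
lemma ae_exists_departure (h : Q.IsRun x μ X E) (hx : Q.IsStationary x) :
    ∀ᵐ ω ∂μ, ∀ k, 0 < (X k ω).len₁ + (X k ω).len₂ → ∃ i, (E (k + i) ω).end₂ = true :=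
  ae_all_iff.2 fun k => (h.shift hx k).ae_exists_departure_zero hx

end IsRun

end TandemQueue

/-! ### Delays and Little's law. -/

/-- Integrated, this is the tail formula for the mean, with infinite values included. -/
lemma ENat.toENNReal_eq_tsum_lt (T : ℕ∞) :
    (T : ℝ≥0∞) = ∑' n : ℕ, if (n : ℕ∞) < T then 1 else 0 := by
  induction T using ENat.recTopCoe with
  | top => simp
  | coe m =>
    rw [tsum_eq_sum (s := Finset.range m) fun n hn => if_neg (by simpa using hn),
      Finset.sum_congr rfl fun n hn => if_pos (by simpa using hn)]
    simp

/-- At `⊤` the right-hand side would be 0; hence almost sure finiteness of the delay is needed for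
the formula with `PW_n`. -/
lemma ENat.toENNReal_eq_tsum_eq {T : ℕ∞} (hT : T ≠ ⊤) :
    (T : ℝ≥0∞) = ∑' n : ℕ, ((n + 1 : ℕ) : ℝ≥0∞) * if T = ((n + 1 : ℕ) : ℕ∞) then 1 else 0 := by
  lift T to ℕ using hT
  rcases T with _ | m
  · refine Eq.trans (by simp) (ENNReal.tsum_eq_zero.2 fun n => ?_).symm
    rw [if_neg (by exact_mod_cast (Nat.succ_ne_zero n).symm), mul_zero]
  · rw [tsum_eq_single m fun n hn => by
      rw [if_neg (by exact_mod_cast fun h => hn (Nat.succ_injective h).symm), mul_zero]]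
    simp

namespace TandemQueue

section Path

variable {Q : TandemQueue} {Ω : Type*} {X : ℕ → Ω → Q.State} {E : ℕ → Ω → Event}

lemma departures_mono (E : ℕ → Ω → Event) (k : ℕ) (ω : Ω) :
    Monotone fun n => departures E k n ω := fun _ _ h =>
  Finset.sum_le_sum_of_subset (Finset.range_mono h)

lemma departures_zero_succ (E : ℕ → Ω → Event) (n : ℕ) (ω : Ω) :
    departures E 0 (n + 1) ω = departures E 1 n ω + if (E 0 ω).end₂ then 1 else 0 := by
  simp only [departures, Finset.sum_range_succ', zero_add, add_comm 1]

/-- A task is still in the system after `n` slots when fewer tasks have left than were present. -/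
lemma lt_delay_iff (k n : ℕ) (ω : Ω) :
    (n : ℕ∞) < Q.delay X E k ω ↔
      departures E (k + 1) n ω < (X (k + 1) ω).len₁ + (X (k + 1) ω).len₂ := by
  constructor
  · intro h
    by_contra! hle
    exact absurd h (not_lt.2 (iInf₂_le n hle))
  · intro h
    refine lt_of_lt_of_le (b := ((n + 1 : ℕ) : ℕ∞)) (by exact_mod_cast Nat.lt_succ_self n)
      (le_iInf₂ fun m hm => ?_)
    have : n < m := by
      by_contra! hmn
      exact absurd (hm.trans (departures_mono E (k + 1) ω hmn)) (not_le.2 h)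
    exact_mod_cast this

/-- Entries only add tasks. So while fewer tasks have left than were present initially, the system
is nonempty and a further departure must follow. -/
lemma total_le_add_departures {ω : Ω}
    (hω : ∀ i, 0 < Q.kernel (X i ω) (E i ω) (X (i + 1) ω)) (n : ℕ) :
    (X 0 ω).len₁ + (X 0 ω).len₂ ≤ (X n ω).len₁ + (X n ω).len₂ + departures E 0 n ω := by
  induction n with
  | zero => simp
  | succ n ih =>
    have hb := total_balance (hω n)
    have hd : departures E 0 (n + 1) ω =
        departures E 0 n ω + if (E n ω).end₂ then 1 else 0 := by
      simp only [departures, Finset.sum_range_succ, zero_add]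
    rw [hd]
    omega

end Path

variable {Q : TandemQueue} {Ω : Type*} [MeasurableSpace Ω] {x : Q.State → ℝ} {μ : Measure Ω}
  {X : ℕ → Ω → Q.State} {E : ℕ → Ω → Event}

namespace IsRun

/-- Almost surely, all tasks that are present leave the system. -/
lemma ae_exists_le_departures (h : Q.IsRun x μ X E) (hx : Q.IsStationary x) :
    ∀ᵐ ω ∂μ, ∃ n, (X 0 ω).len₁ + (X 0 ω).len₂ ≤ departures E 0 n ω := by
  filter_upwards [h.ae_kernel_pos hx, h.ae_exists_departure hx] with ω hker hdep
  suffices H : ∀ r ≤ (X 0 ω).len₁ + (X 0 ω).len₂, ∃ n, r ≤ departures E 0 n ω from H _ le_rfl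
  intro r
  induction r with
  | zero => exact fun _ => ⟨0, Nat.zero_le _⟩
  | succ r ih =>
    intro hr
    obtain ⟨n, hn⟩ := ih (by omega)
    by_cases hlt : r < departures E 0 n ω
    · exact ⟨n, hlt⟩
    have hle := total_le_add_departures hker n
    obtain ⟨i, hi⟩ := hdep n (by omega)
    refine ⟨n + i + 1, ?_⟩
    have hmono := departures_mono E 0 ω (Nat.le_add_right n i)
    have hd : departures E 0 (n + i + 1) ω = departures E 0 (n + i) ω + 1 := by
      simp only [departures, Finset.sum_range_succ, zero_add, hi, if_true]
    simp only at hmono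
    omega

lemma measurableSet_enters (h : Q.IsRun x μ X E) (k : ℕ) : MeasurableSet (Q.enters X E k) :=
  h.measurableSet_setOf k k fun s e => Q.Admits s e

lemma measurableSet_arrives (h : Q.IsRun x μ X E) (k : ℕ) : MeasurableSet (arrives E k) :=
  h.measurableSet_setOf k k fun _ e => e.arrival = true

lemma measurableSet_lt_delay (h : Q.IsRun x μ X E) (k n : ℕ) :
    MeasurableSet {ω | (n : ℕ∞) < Q.delay X E k ω} := by
  simp only [lt_delay_iff]
  exact measurableSet_lt (h.measurable_departures (k + 1) n)
    (h.measurable_comp_state (k + 1) fun s => s.len₁ + s.len₂)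

lemma measurableSet_delay_eq (h : Q.IsRun x μ X E) (k n : ℕ) :
    MeasurableSet {ω | Q.delay X E k ω = ((n + 1 : ℕ) : ℕ∞)} := by
  have : {ω | Q.delay X E k ω = ((n + 1 : ℕ) : ℕ∞)} =
      {ω | (n : ℕ∞) < Q.delay X E k ω} \ {ω | ((n + 1 : ℕ) : ℕ∞) < Q.delay X E k ω} := by
    ext ω
    have h1 : (n : ℕ∞) < Q.delay X E k ω ↔ ((n + 1 : ℕ) : ℕ∞) ≤ Q.delay X E k ω := by
      rw [Nat.cast_add, Nat.cast_one]
      exact (ENat.add_one_le_iff (ENat.natCast_ne_top n)).symm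
    simp only [Set.mem_sdiff, Set.mem_ofPred_eq, h1, not_lt]
    exact ⟨fun h => ⟨h.ge, h.le⟩, fun h => le_antisymm h.2 h.1⟩
  rw [this]
  exact (h.measurableSet_lt_delay k n).diff (h.measurableSet_lt_delay k (n + 1))

/-- The mean number of tasks among those present at time `0` that are still there after `n` slots
decreases by the probability that a task enters and stays longer than `n` slots. -/
lemma lintegral_backlog_eq (h : Q.IsRun x μ X E) (hx : Q.IsStationary x) (n : ℕ) :
    ∫⁻ ω, (((X 0 ω).len₁ + (X 0 ω).len₂ - departures E 0 n ω : ℕ) : ℝ≥0∞) ∂μ =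
      ∫⁻ ω, (((X 0 ω).len₁ + (X 0 ω).len₂ - departures E 0 (n + 1) ω : ℕ) : ℝ≥0∞) ∂μ +
        μ (Q.enters X E 0 ∩ {ω | (n : ℕ∞) < Q.delay X E 0 ω}) := by
  -- Stationarity: the backlog has the same mean when counted from time 1.
  have hshift : ∫⁻ ω, (((X 0 ω).len₁ + (X 0 ω).len₂ - departures E 0 n ω : ℕ) : ℝ≥0∞) ∂μ =
      ∫⁻ ω, (((X 1 ω).len₁ + (X 1 ω).len₂ - departures E 1 n ω : ℕ) : ℝ≥0∞) ∂μ := by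
    have := h.lintegral_eq (h.shift hx 1) n (fun s e => (((s 0).len₁ + (s 0).len₂ -
      ∑ i ∈ Finset.range n, (if (e i).end₂ then 1 else 0) : ℕ) : ℝ≥0∞))
      (fun s s' e e' hs he => by
        rw [hs 0 (Nat.zero_le n), Finset.sum_congr rfl fun i hi => by
          rw [he i (Finset.mem_range.1 hi)]])
    simpa only [departures, zero_add] using this
  have hmeas : MeasurableSet (Q.enters X E 0 ∩ {ω | (n : ℕ∞) < Q.delay X E 0 ω}) :=
    (h.measurableSet_enters 0).inter (h.measurableSet_lt_delay 0 n)
  rw [hshift, ← lintegral_indicator_one hmeas, ← lintegral_add_right _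
    (measurable_one.indicator hmeas)]
  refine lintegral_congr_ae ?_
  filter_upwards [h.ae_kernel_pos hx] with ω hω
  have hb := total_balance (hω 0)
  rw [departures_zero_succ]
  -- By the balance over slot 0, both backlogs come from the same difference up to the entering
  -- task. The truncation at 0 lets this task count exactly when its delay exceeds `n`.
  by_cases he : Q.Admits (X 0 ω) (E 0 ω)
  · rw [if_pos he] at hb
    by_cases hd : departures E 1 n ω < (X 1 ω).len₁ + (X 1 ω).len₂
    · rw [Set.indicator_of_mem (show ω ∈ Q.enters X E 0 ∩ _ from
        ⟨he, (lt_delay_iff 0 n ω).2 hd⟩), Pi.one_apply, ← Nat.cast_add_one]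
      congr 1
      simp only [zero_add] at hb
      omega
    · rw [Set.indicator_of_notMem fun hm => hd ((lt_delay_iff 0 n ω).1 hm.2), add_zero]
      congr 1
      simp only [zero_add] at hb
      omega
  · rw [if_neg he] at hb
    rw [Set.indicator_of_notMem fun hm => he hm.1, add_zero]
    congr 1
    simp only [zero_add] at hb
    omega

/-- The backlog is bounded by `N₁ + N₂` and almost surely vanishes from some `n` on. -/
lemma tendsto_lintegral_backlog [IsProbabilityMeasure μ] (h : Q.IsRun x μ X E)
    (hx : Q.IsStationary x) :
    Filter.Tendsto (fun n => ∫⁻ ω, (((X 0 ω).len₁ + (X 0 ω).len₂ - departures E 0 n ω : ℕ) :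
      ℝ≥0∞) ∂μ) Filter.atTop (nhds 0) := by
  rw [← lintegral_zero (μ := μ)]
  refine tendsto_lintegral_of_dominated_convergence (fun _ => ((Q.N₁ + Q.N₂ : ℕ) : ℝ≥0∞))
    (fun n => ?_) (fun n => Filter.Eventually.of_forall fun ω => ?_) ?_ ?_
  · exact measurable_from_top.comp ((h.measurable_comp_state 0 fun s => s.len₁ + s.len₂).sub
      (h.measurable_departures 0 n))
  · have h1 := (X 0 ω).len₁_le
    have h2 := (X 0 ω).len₂_le
    exact Nat.cast_le.2 (by omega)
  · simp [ENNReal.add_eq_top]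
  · filter_upwards [h.ae_exists_le_departures hx] with ω hω
    obtain ⟨n, hn⟩ := hω
    refine tendsto_const_nhds.congr' ?_
    filter_upwards [Filter.eventually_ge_atTop n] with m hm
    rw [Nat.sub_eq_zero_of_le (hn.trans (departures_mono E 0 ω hm)), Nat.cast_zero]

lemma lintegral_total (h : Q.IsRun x μ X E) (hx : Q.IsStationary x) :
    ∫⁻ ω, (((X 0 ω).len₁ + (X 0 ω).len₂ : ℕ) : ℝ≥0∞) ∂μ = ENNReal.ofReal (Q.meanNumber x) := by
  let _ : MeasurableSpace Q.State := ⊤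
  have hX : Measurable (X 0) := measurable_to_countable' (h.measurable_state 0)
  rw [← lintegral_map (f := fun s : Q.State => ((s.len₁ + s.len₂ : ℕ) : ℝ≥0∞))
    measurable_from_top hX, lintegral_fintype, meanNumber_eq_sum,
    ENNReal.ofReal_sum_of_nonneg fun s _ => mul_nonneg (hx.1 s) (Nat.cast_nonneg _)]
  refine Finset.sum_congr rfl fun s _ => ?_
  rw [Measure.map_apply hX MeasurableSpace.measurableSet_top, ENNReal.ofReal_mul (hx.1 s),
    ENNReal.ofReal_natCast, ← h.measure_init s, mul_comm]
  rfl

/-- Little's law: the delay per entering task, weighted by the probability of entering, sums up to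
the mean number of tasks. -/
theorem setLIntegral_delay [IsProbabilityMeasure μ] (h : Q.IsRun x μ X E)
    (hx : Q.IsStationary x) :
    ∫⁻ ω in Q.enters X E 0, ((Q.delay X E 0 ω : ℕ∞) : ℝ≥0∞) ∂μ =
      ENNReal.ofReal (Q.meanNumber x) := by
  -- The telescoped identity is kept additive, which avoids truncated subtraction in `ℝ≥0∞`.
  have hpart : ∀ M, ∑ n ∈ Finset.range M, μ (Q.enters X E 0 ∩ {ω | (n : ℕ∞) < Q.delay X E 0 ω}) +
      ∫⁻ ω, (((X 0 ω).len₁ + (X 0 ω).len₂ - departures E 0 M ω : ℕ) : ℝ≥0∞) ∂μ =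
      ENNReal.ofReal (Q.meanNumber x) := by
    intro M
    induction M with
    | zero => simpa [departures] using h.lintegral_total hx
    | succ M ih =>
      rw [← ih, h.lintegral_backlog_eq hx M, Finset.sum_range_succ]
      ring
  have htsum : ∑' n : ℕ, μ (Q.enters X E 0 ∩ {ω | (n : ℕ∞) < Q.delay X E 0 ω}) =
      ENNReal.ofReal (Q.meanNumber x) := by
    have hlim := (ENNReal.tendsto_nat_tsum fun n : ℕ =>
      μ (Q.enters X E 0 ∩ {ω | (n : ℕ∞) < Q.delay X E 0 ω})).add (h.tendsto_lintegral_backlog hx)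
    rw [add_zero] at hlim
    refine tendsto_nhds_unique hlim ?_
    simp only [hpart]
    exact tendsto_const_nhds
  rw [← htsum]
  simp only [ENat.toENNReal_eq_tsum_lt]
  rw [lintegral_tsum fun n => (Measurable.ite (h.measurableSet_lt_delay 0 n) measurable_const
    measurable_const).aemeasurable]
  refine tsum_congr fun n => ?_
  have : (fun ω => if (n : ℕ∞) < Q.delay X E 0 ω then (1 : ℝ≥0∞) else 0) =
      {ω | (n : ℕ∞) < Q.delay X E 0 ω}.indicator 1 := by
    ext ω
    simp [Set.indicator_apply]
  rw [this, lintegral_indicator_one (h.measurableSet_lt_delay 0 n),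
    Measure.restrict_apply (h.measurableSet_lt_delay 0 n), Set.inter_comm]

/-- All tasks present at time 1 leave almost surely, the one that has just entered included. -/
lemma ae_delay_ne_top (h : Q.IsRun x μ X E) (hx : Q.IsStationary x) :
    ∀ᵐ ω ∂μ, Q.delay X E 0 ω ≠ ⊤ := by
  filter_upwards [(h.shift hx 1).ae_exists_le_departures hx] with ω hω
  obtain ⟨n, hn⟩ := hω
  simp only [departures, zero_add] at hn
  exact ne_top_of_le_ne_top (ENat.natCast_ne_top n) (iInf₂_le (f := fun (n : ℕ)
    (_ : (X (0 + 1) ω).len₁ + (X (0 + 1) ω).len₂ ≤ departures E (0 + 1) n ω) => (n : ℕ∞)) n hn)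

lemma measure_arrives (h : Q.IsRun x μ X E) (hx : Q.IsStationary x) :
    μ (arrives E 0) =
      ENNReal.ofReal (Q.arr.rate fun p => ∑ s : Q.State, if s.phase = p then x s else 0) := by
  have hY : ∀ z : Q.State × Event × Q.State,
      MeasurableSet ((fun ω => (X 0 ω, E 0 ω, X 1 ω)) ⁻¹' {z}) := by
    rintro ⟨s, e, s'⟩
    have : (fun ω => (X 0 ω, E 0 ω, X 1 ω)) ⁻¹' {(s, e, s')} =
        X 0 ⁻¹' {s} ∩ (E 0 ⁻¹' {e} ∩ X 1 ⁻¹' {s'}) := by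
      ext ω
      simp
    rw [this]
    exact (h.measurable_state 0 s).inter ((h.measurable_event 0 e).inter (h.measurable_state 1 s'))
  have hz : ∀ (s : Q.State) (c : Bool) (d : Bool × Bool) (s' : Q.State),
      μ (arrives E 0 ∩ (fun ω => (X 0 ω, E 0 ω, X 1 ω)) ⁻¹' {(s, (c, d), s')}) =
        if c then ENNReal.ofReal (x s * Q.kernel s (c, d) s') else 0 := by
    intro s c d s'
    cases c
    · rw [if_neg (by simp)]
      refine measure_mono_null (t := ∅) ?_ measure_empty
      rintro ω ⟨h1, h2⟩
      have h1 : (E 0 ω).arrival = true := h1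
      have h2 : E 0 ω = (false, d) := congrArg (fun z => z.2.1) h2
      simp [h2, Event.arrival] at h1
    · rw [if_pos rfl, ← h.measure_step]
      congr 1
      ext ω
      simp only [arrives, Set.mem_inter_iff, Set.mem_preimage, Set.mem_singleton_iff,
        Prod.mk.injEq, Set.mem_ofPred_eq, and_iff_right_iff_imp]
      rintro ⟨-, h2, -⟩
      simp [h2, Event.arrival]
  rw [measure_eq_sum_inter_preimage μ hY, ← sum_kernel_arrival]
  have hnn : ∀ (s : Q.State) (d : Bool × Bool) (s' : Q.State),
      0 ≤ x s * Q.kernel s (true, d) s' := fun s d s' => mul_nonneg (hx.1 s) (kernel_nonneg _ _ _)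
  simp only [Finset.mul_sum]
  rw [ENNReal.ofReal_sum_of_nonneg fun s _ => Finset.sum_nonneg fun d _ =>
    Finset.sum_nonneg fun s' _ => hnn s d s', Fintype.sum_prod_type]
  refine Finset.sum_congr rfl fun s _ => ?_
  rw [ENNReal.ofReal_sum_of_nonneg fun d _ => Finset.sum_nonneg fun s' _ => hnn s d s',
    Fintype.sum_prod_type, Fintype.sum_prod_type]
  simp only [hz, Fintype.sum_bool, if_true, Bool.false_eq_true, if_false, Finset.sum_const_zero,
    add_zero]
  exact Finset.sum_congr rfl fun d _ => (ENNReal.ofReal_sum_of_nonneg fun s' _ => hnn s d s').symm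

/-- Tasks enter with positive probability, if they arrive with positive probability. -/
lemma measure_enters_ne_zero [IsProbabilityMeasure μ] (h : Q.IsRun x μ X E)
    (hx : Q.IsStationary x) (harr : μ (arrives E 0) ≠ 0) : μ (Q.enters X E 0) ≠ 0 := by
  intro h0
  -- Little's law holds before any conditioning: if no task enters, the mean number of tasks is 0,
  -- and an arrival at an empty system is admitted because `1 ≤ N₁`.
  have hL : ∫⁻ ω, (((X 0 ω).len₁ + (X 0 ω).len₂ : ℕ) : ℝ≥0∞) ∂μ = 0 := by
    rw [h.lintegral_total hx, ← h.setLIntegral_delay hx, Measure.restrict_eq_zero.2 h0,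
      lintegral_zero_measure]
  rw [lintegral_eq_zero_iff (h.measurable_comp_state 0 fun s =>
    ((s.len₁ + s.len₂ : ℕ) : ℝ≥0∞))] at hL
  refine harr (measure_mono_null_ae ?_ h0)
  filter_upwards [hL] with ω hω harr
  have hω : (((X 0 ω).len₁ + (X 0 ω).len₂ : ℕ) : ℝ≥0∞) = 0 := hω
  have hω := Nat.cast_eq_zero.1 hω
  have hN := Q.one_le_N₁
  exact ⟨harr, by omega⟩

end IsRun

end TandemQueue

/-! ### The offloading ratio and the average delay. -/

open TandemQueue in
/-- The offloading ratio and the average delay for slot `0`. -/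
theorem offloadingRatio_pos_and_averageDelay_zero (Q : TandemQueue)
    (π : Fin Q.m → ℝ)
    (hπ_unique : ∀ π' : Fin Q.m → ℝ, Q.arr.IsStationary π' → π' = π)
    (hrate : 0 < Q.arr.rate π)
    (x : Q.State → ℝ) (hx : Q.IsStationary x)
    {Ω : Type*} [MeasurableSpace Ω] (μ : Measure Ω) [IsProbabilityMeasure μ]
    (X : ℕ → Ω → Q.State) (E : ℕ → Ω → TandemQueue.Event) (hrun : Q.IsRun x μ X E) :
    0 < Q.offloadingRatio μ X E 0 ∧
    Q.averageDelay μ X E 0 = ∑' n : ℕ, ((n + 1 : ℕ) : ℝ≥0∞) * Q.delayProb μ X E 0 (n + 1) ∧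
    Q.averageDelay μ X E 0 =
      ENNReal.ofReal (Q.meanNumber x / (Q.arr.rate π * Q.offloadingRatio μ X E 0)) := by
  have harr : μ (arrives E 0) = ENNReal.ofReal (Q.arr.rate π) := by
    rw [hrun.measure_arrives hx, hπ_unique _ (isStationary_phase hx)]
  have harr0 : μ (arrives E 0) ≠ 0 := by
    rw [harr]
    exact (ENNReal.ofReal_pos.2 hrate).ne'
  have hent0 := hrun.measure_enters_ne_zero hx harr0
  have hentm := hrun.measurableSet_enters 0
  -- A task that enters has arrived, so the conditional probability is `P(enter) / λ`.
  have hratio : Q.offloadingRatio μ X E 0 = (Q.arr.rate π)⁻¹ * (μ (Q.enters X E 0)).toReal := by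
    rw [offloadingRatio, cond_apply (hrun.measurableSet_arrives 0),
      Set.inter_eq_right.2 fun ω hω => hω.1, ENNReal.toReal_mul, ENNReal.toReal_inv, harr,
      ENNReal.toReal_ofReal hrate.le]
  have hentpos : 0 < (μ (Q.enters X E 0)).toReal := ENNReal.toReal_pos hent0 (measure_ne_top _ _)
  refine ⟨by rw [hratio]; positivity, ?_, ?_⟩
  · have hae : ∀ᵐ ω ∂μ[|Q.enters X E 0], Q.delay X E 0 ω ≠ ⊤ :=
      cond_absolutelyContinuous.ae_le (hrun.ae_delay_ne_top hx)
    rw [averageDelay, lintegral_congr_ae (hae.mono fun ω hω => ENat.toENNReal_eq_tsum_eq hω),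
      lintegral_tsum fun n => ((Measurable.ite (hrun.measurableSet_delay_eq 0 n) measurable_const
        measurable_const).const_mul _).aemeasurable]
    refine tsum_congr fun n => ?_
    have : (fun ω => if Q.delay X E 0 ω = ((n + 1 : ℕ) : ℕ∞) then (1 : ℝ≥0∞) else 0) =
        {ω | Q.delay X E 0 ω = ((n + 1 : ℕ) : ℕ∞)}.indicator 1 := by
      ext ω
      simp only [Set.indicator_apply, Set.mem_ofPred_eq, Pi.one_apply]
    rw [lintegral_const_mul _ (Measurable.ite (hrun.measurableSet_delay_eq 0 n) measurable_const
      measurable_const), this, lintegral_indicator_one (hrun.measurableSet_delay_eq 0 n)]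
    rfl
  · rw [averageDelay, ProbabilityTheory.cond, lintegral_smul_measure,
      hrun.setLIntegral_delay hx, hratio, mul_inv_cancel_left₀ hrate.ne', div_eq_inv_mul,
      ENNReal.ofReal_mul (inv_nonneg.2 hentpos.le), ENNReal.ofReal_inv_of_pos hentpos,
      ENNReal.ofReal_toReal (measure_ne_top _ _), smul_eq_mul]

theorem proposition2 (Q : TandemQueue)
    (π : Fin Q.m → ℝ) (hπ : Q.arr.IsStationary π)
    (hπ_unique : ∀ π' : Fin Q.m → ℝ, Q.arr.IsStationary π' → π' = π)
    (hrate : 0 < Q.arr.rate π)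
    (x : Q.State → ℝ) (hx : Q.IsStationary x)
    {Ω : Type*} [MeasurableSpace Ω] (μ : Measure Ω) [IsProbabilityMeasure μ]
    (X : ℕ → Ω → Q.State) (E : ℕ → Ω → TandemQueue.Event) (hrun : Q.IsRun x μ X E) (k : ℕ) :
    0 < Q.offloadingRatio μ X E k ∧
    Q.averageDelay μ X E k = ∑' n : ℕ, ((n + 1 : ℕ) : ℝ≥0∞) * Q.delayProb μ X E k (n + 1) ∧
    Q.averageDelay μ X E k =
      ENNReal.ofReal (Q.meanNumber x / (Q.arr.rate π * Q.offloadingRatio μ X E k)) := by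
  -- Slot `k` is slot 0 of the shifted run, which has the same initial distribution. Only `delay`
  -- needs rewriting; the other quantities agree definitionally.
  have hdelay : Q.delay (fun i => X (k + i)) (fun i => E (k + i)) 0 = Q.delay X E k := by
    funext ω
    simp only [TandemQueue.delay, TandemQueue.departures, zero_add, add_assoc]
  have h := offloadingRatio_pos_and_averageDelay_zero Q π hπ_unique hrate x hx μ _ _ (hrun.shift hx k)
  simp only [TandemQueue.averageDelay, TandemQueue.delayProb, hdelay] at h
  exact h
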